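/- **Setting.** Let $(X,\mathcal U)$ be a compact (Hausdorff) Kähler orbifold of complex dimension $n\ge 1$ with maximal atlas $\mathcal U$ of uniformising charts $(\tilde U,\Gamma,\varphi)$ ($\tilde U\subset\mathbb C^n$ open and connected, $\Gamma$ a finite group acting effectively on $\tilde U$ by biholomorphisms, $\varphi$ inducing a homeomorphism of $\tilde U/\Gamma$ onto an open subset of $X$). Let $D\subset X$ be a connected closed complex suborbifold of codimension one (around each point of $D$ there is a chart $\tilde U$ in which $\tilde D:=\varphi^{-1}(D\cap\varphi(\tilde U))$ is a complex submanifold of codimension one) that contains every singular point of $X$ (point with non-trivial isotropy group). A *defining function* of $D$ on a chart $\tilde U$ is a holomorphic function $\tilde s$ on $\tilde U$ with $\tilde D=\{\tilde s=0\}$ and $d\tilde s\neq 0$ along $\tilde D$; the charts that admit one form an atlas of $X$, and the corresponding $\tilde D$ form an atlas of the orbifold $D$. Let $K_X$, $K_D$ be the canonical orbibundles, $N_D^*$ the conormal orbibundle of $D$ in $X$ (fibre at $z\in\tilde D$: the covectors on $T_z\tilde U$ vanishing on $T_z\tilde D$), and $[D]$ the line orbibundle on $X$ given by the cocycle $f_k/(f_l\circ\lambda)$,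 where the $f_k$ are defining functions of $D$ on the charts $\tilde U_k$ and $\lambda:\tilde U_k\to\tilde U_l$ runs over the injections of charts. Tensor powers are written additively. **Assumptions.** Let $\alpha\in\mathbb N$, $\alpha\ge 2$, and suppose that 1. $-K_X\cong\alpha[D]$ as holomorphic line orbibundles on $X$; 2. (basic assumption) every point of $D$ lies in $\varphi(\tilde U)$ for some chart $(\tilde U,\Gamma,\varphi)$ of $X$ with holomorphic coordinates $(z_1,\dots,z_n)$ on $\tilde U$ in which $\tilde D=\{z_n=0\}$ and each $\gamma\in\Gamma$ acts as a matrix $\begin{pmatrix}A&\star\\0&a\end{pmatrix}$ with $A\in GL(n-1,\mathbb C)$ and $a^{\alpha-1}=\det A$. **Proposition.** There is an isomorphism of holomorphic line orbibundles on $D$ $$K_D\;\cong\;(\alpha-1)N_D^*.$$ More precisely: * There exists a trivialising (holomorphic, nowhere vanishing) section $\Omega$ of $K_{X\setminus D}$ that, as a section of $K_X$, blows up to order $\alpha$ along $D$; that is, on each of the above charts, for some defining function $\tilde s$ of $D$, the form $\tilde s^{\alpha}\varphi^*\Omega$ extends to a nowhere vanishing holomorphic $n$-form on $\tilde U$. *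 Each such $\Omega$ determines an isomorphism: there is exactly one isomorphism of holomorphic line orbibundles $\psi:(\alpha-1)N_D^*\to K_D$ that is given by the Poincaré residue of $\Omega$, i.e. such that, on each of the above charts, for every defining function $\tilde s$ of $D$ for which $\tilde s^\alpha\varphi^*\Omega$ extends holomorphically to $\tilde U$ and every $z\in\tilde D$, $$\psi\big(d\tilde s^{\otimes(\alpha-1)}|_z\big)=\Big((\tilde s^{\alpha}\varphi^*\Omega)\,\lrcorner\,\tfrac{\partial}{\partial\tilde s}\Big)\Big|_{T_z\tilde D},$$ where $\partial/\partial\tilde s$ is represented by any $v\in T_z\tilde U$ with $d\tilde s(v)=1$ and $(\eta\lrcorner v)=\eta(v,\cdot,\dots,\cdot)$. -/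

import Mathlib

open Filter Topology

namespace OrbiAdj

universe u

/-- The complex vector space `ℂⁿ`. -/
abbrev Cn (n : ℕ) : Type := Fin n → ℂ

/-! ### Complex orbifolds -/

/-- A (complex) uniformising chart `(Ũ, Γ, φ)` on `X`: `Ũ = dom` is a connected open subset of `ℂⁿ`
containing the origin, `Γ` is a finite group acting effectively on `Ũ` by biholomorphisms, and
`φ = proj : Ũ → X` is continuous and open and induces an injection (hence a homeomorphism onto an
open subset of `X`) on `Ũ / Γ`. The maps `act γ` and `proj` are total functions whose values outside
`dom` are irrelevant. -/
structure OrbiChart (X : Type u) [TopologicalSpace X] (n : ℕ) where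
  dom : Set (Cn n)
  isOpen_dom : IsOpen dom
  isConnected_dom : IsConnected dom
  zero_mem : (0 : Cn n) ∈ dom
  Γ : Type
  [group : Group Γ]
  [finite : Finite Γ]
  act : Γ → Cn n → Cn n
  act_mapsTo : ∀ γ, Set.MapsTo (act γ) dom dom
  act_one : ∀ x ∈ dom, act 1 x = x
  act_mul : ∀ γ δ, ∀ x ∈ dom, act (γ * δ) x = act γ (act δ x)
  act_holomorphic : ∀ γ, AnalyticOnNhd ℂ (act γ) dom
  effective : ∀ γ, (∀ x ∈ dom, act γ x = x) → γ = 1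
  proj : Cn n → X
  continuousOn_proj : ContinuousOn proj dom
  isOpen_image_proj : ∀ O ⊆ dom, IsOpen O → IsOpen (proj '' O)
  proj_eq_iff : ∀ x ∈ dom, ∀ y ∈ dom, proj x = proj y ↔ ∃ γ, act γ x = y

attribute [instance] OrbiChart.group OrbiChart.finite

/-- The open set `U = φ(Ũ)` of `X` covered by a chart. -/
def OrbiChart.range {X : Type u} [TopologicalSpace X] {n : ℕ} (c : OrbiChart X n) : Set X :=
  c.proj '' c.dom

/-- The preimage `φ⁻¹(D ∩ φ(Ũ)) ⊆ Ũ` of a subset `D` of `X`. -/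
def OrbiChart.preimage {X : Type u} [TopologicalSpace X] {n : ℕ} (c : OrbiChart X n) (D : Set X) :
    Set (Cn n) :=
  {x | x ∈ c.dom ∧ c.proj x ∈ D}

/-- `l` is an injection (embedding) of charts `(Ũ, Γ, φ) → (Ũ', Γ', φ')`: a holomorphic embedding
`Ũ → Ũ'` with `φ' ∘ l = φ`. (An injective immersion between open subsets of `ℂⁿ` is an open
embedding.) -/
structure IsInjection {X : Type u} [TopologicalSpace X] {n : ℕ} (c c' : OrbiChart X n)
    (l : Cn n → Cn n) : Prop where
  holomorphic : AnalyticOnNhd ℂ l c.dom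
  mapsTo : Set.MapsTo l c.dom c'.dom
  injOn : Set.InjOn l c.dom
  injective_fderiv : ∀ x ∈ c.dom, Function.Injective (fderiv ℂ l x)
  proj_comp : ∀ x ∈ c.dom, c'.proj (l x) = c.proj x

/-- Injections compose. -/
theorem IsInjection.comp {X : Type u} [TopologicalSpace X] {n : ℕ} {c c' c'' : OrbiChart X n}
    {l k : Cn n → Cn n} (hl : IsInjection c c' l) (hk : IsInjection c' c'' k) :
    IsInjection c c'' (k ∘ l) where
  holomorphic x hx := (hk.holomorphic _ (hl.mapsTo hx)).comp (hl.holomorphic x hx)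
  mapsTo := hk.mapsTo.comp hl.mapsTo
  injOn := hk.injOn.comp hl.injOn hl.mapsTo
  injective_fderiv x hx := by
    rw [fderiv_comp x (hk.holomorphic _ (hl.mapsTo hx)).differentiableAt
      (hl.holomorphic x hx).differentiableAt]
    exact (hk.injective_fderiv _ (hl.mapsTo hx)).comp (hl.injective_fderiv x hx)
  proj_comp x hx := by
    rw [Function.comp_apply, hk.proj_comp _ (hl.mapsTo hx), hl.proj_comp x hx]

/-- Each element of the local uniformising group is an injection of the chart into itself. Hence
compatibility with all injections, as required of orbibundles and of their sections and isomorphisms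
below, contains `Γ`-equivariance. -/
theorem isInjection_act {X : Type u} [TopologicalSpace X] {n : ℕ} (c : OrbiChart X n) (γ : c.Γ) :
    IsInjection c c (c.act γ) where
  holomorphic := c.act_holomorphic γ
  mapsTo := c.act_mapsTo γ
  injOn x hx y hy h := by
    have := congrArg (c.act γ⁻¹) h
    rwa [← c.act_mul _ _ x hx, ← c.act_mul _ _ y hy, inv_mul_cancel, c.act_one x hx,
      c.act_one y hy] at this
  injective_fderiv x hx := by
    have h1 : (c.act γ⁻¹ ∘ c.act γ) =ᶠ[𝓝 x] id := by
      filter_upwards [c.isOpen_dom.mem_nhds hx] with y hy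
      rw [Function.comp_apply, ← c.act_mul _ _ y hy, inv_mul_cancel, c.act_one y hy, id]
    have h2 := h1.fderiv_eq (𝕜 := ℂ)
    rw [fderiv_comp x (c.act_holomorphic γ⁻¹ _ (c.act_mapsTo γ hx)).differentiableAt
      (c.act_holomorphic γ x hx).differentiableAt, fderiv_id] at h2
    intro v w hvw
    have h3 := congrArg (fderiv ℂ (c.act γ⁻¹) (c.act γ x)) hvw
    rw [← ContinuousLinearMap.comp_apply, ← ContinuousLinearMap.comp_apply, h2] at h3
    simpa using h3
  proj_comp x hx := ((c.proj_eq_iff x hx _ (c.act_mapsTo γ hx)).2 ⟨γ, rfl⟩).symm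

/-- An orbifold atlas: the charts cover `X`, and any two charts are compatible near each point that
they both cover. -/
structure IsOrbifoldAtlas {X : Type u} [TopologicalSpace X] {n : ℕ} (A : Set (OrbiChart X n)) :
    Prop where
  covers : ∀ x : X, ∃ c ∈ A, x ∈ c.range
  compatible : ∀ c ∈ A, ∀ c' ∈ A, ∀ x ∈ c.range ∩ c'.range,
    ∃ c'' ∈ A, x ∈ c''.range ∧ (∃ l, IsInjection c'' c l) ∧ (∃ l', IsInjection c'' c' l')

/-- A complex orbifold structure of dimension `n` on `X`, given by its maximal orbifold atlas. -/
structure ComplexOrbifold (X : Type u) [TopologicalSpace X] (n : ℕ) where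
  atlas : Set (OrbiChart X n)
  isAtlas : IsOrbifoldAtlas atlas
  maximal : ∀ A : Set (OrbiChart X n), IsOrbifoldAtlas A → atlas ⊆ A → A ⊆ atlas

/-- The set `Sing(X)` of points with non-trivial isotropy group. -/
def ComplexOrbifold.singularSet {X : Type u} [TopologicalSpace X] {n : ℕ}
    (O : ComplexOrbifold X n) : Set X :=
  {p | ∃ c ∈ O.atlas, ∃ x ∈ c.dom, c.proj x = p ∧ ∃ γ : c.Γ, γ ≠ 1 ∧ c.act γ x = x}

/-- `g` is a Kähler metric on the orbifold: a smooth family of Hermitian (that is, positive definite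
symmetric real-bilinear and `J`-invariant) forms on each chart, for which all injections (in
particular the elements of the local uniformising groups) are isometries, and such that
`ω(v, w) = g(iv, w)` is closed. -/
structure ComplexOrbifold.IsKahlerMetric {X : Type u} [TopologicalSpace X] {n : ℕ}
    (O : ComplexOrbifold X n) (g : OrbiChart X n → Cn n → (Cn n →L[ℝ] Cn n →L[ℝ] ℝ)) : Prop where
  smooth : ∀ c ∈ O.atlas, ContDiffOn ℝ (⊤ : ℕ∞) (g c) c.dom
  symm : ∀ c ∈ O.atlas, ∀ x ∈ c.dom, ∀ v w, g c x v w = g c x w v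
  pos : ∀ c ∈ O.atlas, ∀ x ∈ c.dom, ∀ v, v ≠ 0 → 0 < g c x v v
  hermitian : ∀ c ∈ O.atlas, ∀ x ∈ c.dom, ∀ v w,
    g c x (Complex.I • v) (Complex.I • w) = g c x v w
  isometry : ∀ c ∈ O.atlas, ∀ c' ∈ O.atlas, ∀ l, IsInjection c c' l → ∀ x ∈ c.dom, ∀ v w,
    g c' (l x) (fderiv ℂ l x v) (fderiv ℂ l x w) = g c x v w
  closed : ∀ c ∈ O.atlas, ∀ x ∈ c.dom, ∀ a b e : Cn n,
    fderiv ℝ (fun y => g c y (Complex.I • b) e) x a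
      + fderiv ℝ (fun y => g c y (Complex.I • e) a) x b
      + fderiv ℝ (fun y => g c y (Complex.I • a) b) x e = 0

/-! ### Codimension-one suborbifolds -/

/-- `D` is a (closed) complex suborbifold of codimension one: around each of its points there is a
uniformising chart `Ũ` of `X` in which the preimage of `D` is a complex submanifold of codimension
one, that is, locally the zero set of a holomorphic function with non-vanishing differential. -/
structure ComplexOrbifold.IsSuborbifold {X : Type u} [TopologicalSpace X] {n : ℕ}
    (O : ComplexOrbifold X n) (D : Set X) : Prop where
  isClosed : IsClosed D
  exists_chart : ∀ p ∈ D, ∃ c ∈ O.atlas, p ∈ c.range ∧ ∀ x ∈ c.preimage D,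
    ∃ s : Cn n → ℂ, AnalyticAt ℂ s x ∧ fderiv ℂ s x ≠ 0 ∧
      ∀ᶠ y in 𝓝 x, y ∈ c.preimage D ↔ s y = 0

/-- `s` is a defining function of (the preimage of) `D` on the chart `Ũ`: a holomorphic function on
`Ũ` whose zero set is the preimage of `D`, with non-vanishing differential along it. -/
structure IsDefiningFunction {X : Type u} [TopologicalSpace X] {n : ℕ} (c : OrbiChart X n)
    (D : Set X) (s : Cn n → ℂ) : Prop where
  holomorphic : AnalyticOnNhd ℂ s c.dom
  zero_iff : ∀ x ∈ c.dom, s x = 0 ↔ c.proj x ∈ D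
  fderiv_ne_zero : ∀ x ∈ c.preimage D, fderiv ℂ s x ≠ 0

/-- The uniformising charts of `X` on which `D` has a defining function (a nowhere vanishing one if
the chart does not meet `D`). For a closed suborbifold `D` of codimension one these charts form an
atlas of `X`, and their intersections with `D` form an atlas of `D`; they contain the charts of the
basic assumption, on which `z_n` is a defining function. -/
def ComplexOrbifold.DivisorChart {X : Type u} [TopologicalSpace X] {n : ℕ}
    (O : ComplexOrbifold X n) (D : Set X) : Type (max u 1) :=
  {c : OrbiChart X n // c ∈ O.atlas ∧ ∃ s, IsDefiningFunction c D s}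

/-- The basic assumption on the pair `(X, D)`: every point of `D` is covered by a uniformising chart
with holomorphic coordinates `z = (z_1, …, z_n)`, `n = m + 1`, such that `D` is `{z_n = 0}` and each
`γ ∈ Γ` acts as a matrix with blocks `A ∈ GL(n - 1, ℂ)`, `*`, `0` and an `(α - 1)`-th root of
`det A`. -/
def ComplexOrbifold.BasicAssumption {X : Type u} [TopologicalSpace X] {m : ℕ}
    (O : ComplexOrbifold X (m + 1)) (D : Set X) (α : ℕ) : Prop :=
  ∀ p ∈ D, ∃ c ∈ O.atlas, p ∈ c.range ∧ ∃ z : Cn (m + 1) → Cn (m + 1),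
    AnalyticOnNhd ℂ z c.dom ∧ Set.InjOn z c.dom ∧
    (∀ x ∈ c.dom, Function.Bijective (fderiv ℂ z x)) ∧
    (∀ x ∈ c.dom, c.proj x ∈ D ↔ z x (Fin.last m) = 0) ∧
    ∀ γ : c.Γ, ∃ M : Matrix (Fin (m + 1)) (Fin (m + 1)) ℂ,
      (∀ x ∈ c.dom, z (c.act γ x) = M.mulVec (z x)) ∧
      (∀ j : Fin m, M (Fin.last m) j.castSucc = 0) ∧
      (M.submatrix Fin.castSucc Fin.castSucc).det ≠ 0 ∧
      M (Fin.last m) (Fin.last m) ^ (α - 1) = (M.submatrix Fin.castSucc Fin.castSucc).det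

/-! ### Systems of charts and holomorphic line orbibundles

The charts `Ũ` of an orbifold `X` and the charts `D̃ ⊆ Ũ` of a suborbifold `D` are treated on the same
footing: both are complex submanifolds of `ℂⁿ`. -/

/-- The holomorphic tangent space at `x` of a complex submanifold `M` of `ℂⁿ`: the common kernel of
the differentials of the holomorphic functions that vanish on `M` near `x`. -/
def tangent {n : ℕ} (M : Set (Cn n)) (x : Cn n) : Submodule ℂ (Cn n) where
  carrier := {v | ∀ f : Cn n → ℂ, AnalyticAt ℂ f x → (∀ᶠ y in 𝓝[M] x, f y = 0) → fderiv ℂ f x v = 0}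
  add_mem' hv hw f hf h := by rw [map_add, hv f hf h, hw f hf h, add_zero]
  zero_mem' f _ _ := map_zero _
  smul_mem' a v hv f hf h := by rw [map_smul, hv f hf h, smul_zero]

/-- A system of charts of a (possibly non-effective) complex orbifold of dimension `d`: the charts are
`d`-dimensional complex submanifolds of `ℂⁿ`, and the injections are restrictions of holomorphic
immersions. -/
structure ChartSystem (n d : ℕ) where
  Chart : Type u
  carrier : Chart → Set (Cn n)
  Inj : Chart → Chart → Set (Cn n → Cn n)
  mapsTo : ∀ {i j l}, l ∈ Inj i j → Set.MapsTo l (carrier i) (carrier j)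
  holomorphic : ∀ {i j l}, l ∈ Inj i j → AnalyticOnNhd ℂ l (carrier i)
  injective_fderiv : ∀ {i j l}, l ∈ Inj i j → ∀ x ∈ carrier i, Function.Injective (fderiv ℂ l x)
  comp_mem : ∀ {i j k l l'}, l ∈ Inj i j → l' ∈ Inj j k → (fun x => l' (l x)) ∈ Inj i k
  exists_frame : ∀ i, ∀ x ∈ carrier i, ∃ τ : Fin d → Cn n → Cn n, (∀ k, AnalyticAt ℂ (τ k) x) ∧
    ∀ᶠ y in 𝓝[carrier i] x, LinearIndependent ℂ (fun k => τ k y) ∧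
      Submodule.span ℂ (Set.range fun k => τ k y) = tangent (carrier i) y

namespace ChartSystem

variable {n d : ℕ} (S : ChartSystem.{u} n d)

/-- The map of charts underlying an injection. -/
abbrev app {S : ChartSystem.{u} n d} {i j : S.Chart} (l : S.Inj i j) (x : S.carrier i) : S.carrier j :=
  ⟨l.1 x.1, S.mapsTo l.2 x.2⟩

/-- Composition of injections. -/
abbrev comp {S : ChartSystem.{u} n d} {i j k : S.Chart} (l : S.Inj i j) (l' : S.Inj j k) : S.Inj i k :=
  ⟨fun x => l'.1 (l.1 x), S.comp_mem l.2 l'.2⟩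

/-- The holomorphic tangent space of the chart `i` at the point `x`. -/
abbrev T (i : S.Chart) (x : S.carrier i) : Submodule ℂ (Cn n) := tangent (S.carrier i) x.1

/-- The complex-valued function `u` on the chart `i` is holomorphic near `x`. -/
def HolFun (i : S.Chart) (x : S.carrier i) (u : S.carrier i → ℂ) : Prop :=
  ∃ f : Cn n → ℂ, AnalyticAt ℂ f x.1 ∧ ∀ᶠ y in 𝓝 x, u y = f y.1

end ChartSystem

/-- A holomorphic line orbibundle on the orbifold with the system of charts `S`: a holomorphic line
bundle over each chart `i` (with fibres `Fiber i x`, and `IsHol i x σ` saying that the section `σ` is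
holomorphic near `x`), with bundle maps `λ^* = pull λ` for the injections `λ`, functorial in `λ`. -/
structure LineOrbibundle {n d : ℕ} (S : ChartSystem.{u} n d) where
  Fiber : ∀ i, S.carrier i → Type
  [addCommGroup : ∀ i x, AddCommGroup (Fiber i x)]
  [module : ∀ i x, Module ℂ (Fiber i x)]
  IsHol : ∀ i, S.carrier i → (∀ y, Fiber i y) → Prop
  pull : ∀ {i j} (l : S.Inj i j) (x : S.carrier i), Fiber j (ChartSystem.app l x) ≃ₗ[ℂ] Fiber i x
  /-- Near each point there is a local frame `e` such that the holomorphic sections are exactly the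
  multiples of `e` by holomorphic functions. -/
  exists_frame : ∀ i x, ∃ e : ∀ y, Fiber i y,
    (∀ᶠ y in 𝓝 x, e y ≠ 0 ∧ ∀ v : Fiber i y, ∃ a : ℂ, v = a • e y) ∧
    ∀ᶠ y in 𝓝 x, ∀ σ : ∀ y, Fiber i y,
      IsHol i y σ ↔ ∃ u, S.HolFun i y u ∧ ∀ᶠ z in 𝓝 y, σ z = u z • e z
  pull_comp : ∀ {i j k} (l : S.Inj i j) (l' : S.Inj j k) (x : S.carrier i)
    (v : Fiber k (ChartSystem.app (ChartSystem.comp l l') x)),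
    pull (ChartSystem.comp l l') x v = pull l x (pull l' (ChartSystem.app l x) v)
  isHol_pull : ∀ {i j} (l : S.Inj i j) (x : S.carrier i) (σ : ∀ y, Fiber j y),
    IsHol j (ChartSystem.app l x) σ → IsHol i x (fun y => pull l y (σ (ChartSystem.app l y)))

attribute [instance] LineOrbibundle.addCommGroup LineOrbibundle.module

/-- An isomorphism of holomorphic line orbibundles: fibrewise linear isomorphisms over each chart,
biholomorphic (they identify the holomorphic sections) and compatible with the bundle maps of all
injections, in particular with the action of the local uniformising groups. -/
structure LineOrbibundle.Iso {n d : ℕ} {S : ChartSystem.{u} n d} (L L' : LineOrbibundle S) where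
  equiv : ∀ i (x : S.carrier i), L.Fiber i x ≃ₗ[ℂ] L'.Fiber i x
  isHol_iff : ∀ i x σ, L.IsHol i x σ ↔ L'.IsHol i x (fun y => equiv i y (σ y))
  pull_comm : ∀ {i j} (l : S.Inj i j) (x : S.carrier i) (v : L.Fiber j (ChartSystem.app l x)),
    equiv i x (L.pull l x v) = L'.pull l x (equiv j (ChartSystem.app l x) v)

/-! #### Auxiliary facts on holomorphic functions and tangent spaces -/

namespace ChartSystem

variable {n d : ℕ} {S : ChartSystem.{u} n d} {i j : S.Chart}

theorem continuousAt_app (l : S.Inj i j) (x : S.carrier i) : ContinuousAt (app l) x := by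
  have h : ContinuousAt (fun y : S.carrier i => l.1 y.1) x :=
    (S.holomorphic l.2 x.1 x.2).continuousAt.comp continuousAt_subtype_val
  exact tendsto_subtype_rng.2 h

theorem HolFun.comp_app {l : S.Inj i j} {x : S.carrier i} {u : S.carrier j → ℂ}
    (h : S.HolFun j (app l x) u) : S.HolFun i x (fun y => u (app l y)) := by
  obtain ⟨f, hf, hu⟩ := h
  exact ⟨f ∘ l.1, AnalyticAt.comp (f := l.1) hf (S.holomorphic l.2 x.1 x.2),
    (continuousAt_app l x).eventually hu⟩

theorem HolFun.congr {x : S.carrier i} {u v : S.carrier i → ℂ} (h : S.HolFun i x u)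
    (huv : ∀ᶠ y in 𝓝 x, v y = u y) : S.HolFun i x v := by
  obtain ⟨f, hf, hu⟩ := h
  exact ⟨f, hf, by filter_upwards [hu, huv] with y h1 h2; rw [h2, h1]⟩

theorem HolFun.const {x : S.carrier i} (a : ℂ) : S.HolFun i x (fun _ => a) :=
  ⟨fun _ => a, analyticAt_const, Eventually.of_forall fun _ => rfl⟩

theorem HolFun.mul {x : S.carrier i} {u v : S.carrier i → ℂ} (h : S.HolFun i x u)
    (h' : S.HolFun i x v) : S.HolFun i x (fun y => u y * v y) := by
  obtain ⟨f, hf, hu⟩ := h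
  obtain ⟨g, hg, hv⟩ := h'
  exact ⟨fun y => f y * g y, hf.mul hg, by filter_upwards [hu, hv] with y h1 h2; rw [h1, h2]⟩

theorem HolFun.prod {x : S.carrier i} {k : ℕ} {u : Fin k → S.carrier i → ℂ}
    (h : ∀ a, S.HolFun i x (u a)) : S.HolFun i x (fun y => ∏ a, u a y) := by
  choose f hf hu using h
  refine ⟨fun y => ∏ a, f a y, Finset.analyticAt_fun_prod _ fun a _ => hf a, ?_⟩
  filter_upwards [eventually_all.2 hu] with y hy
  exact Finset.prod_congr rfl fun a _ => hy a

theorem HolFun.inv {x : S.carrier i} {u : S.carrier i → ℂ} (h : S.HolFun i x u) (h0 : u x ≠ 0) :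
    S.HolFun i x (fun y => (u y)⁻¹) := by
  obtain ⟨f, hf, hu⟩ := h
  refine ⟨fun y => (f y)⁻¹, hf.inv ?_, by filter_upwards [hu] with y h1; rw [h1]⟩
  rwa [← hu.self_of_nhds]

theorem HolFun.eventually {x : S.carrier i} {u : S.carrier i → ℂ} (h : S.HolFun i x u) :
    ∀ᶠ y in 𝓝 x, S.HolFun i y u := by
  obtain ⟨f, hf, hu⟩ := h
  filter_upwards [continuousAt_subtype_val.eventually hf.eventually_analyticAt,
    eventually_eventually_nhds.2 hu] with y h1 h2
  exact ⟨f, h1, h2⟩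

theorem finrank_T (x : S.carrier i) : Module.finrank ℂ (S.T i x) = d := by
  obtain ⟨τ, -, h⟩ := S.exists_frame i x.1 x.2
  obtain ⟨h1, h2⟩ := h.self_of_nhdsWithin x.2
  rw [T, ← h2, finrank_span_eq_card h1, Fintype.card_fin]

/-- The differential of an injection. -/
theorem fderiv_mem_T (l : S.Inj i j) (x : S.carrier i) (v : Cn n) (hv : v ∈ S.T i x) :
    fderiv ℂ l.1 x.1 v ∈ S.T j (app l x) := by
  intro f hf h0
  have hl := S.holomorphic l.2 x.1 x.2
  have h1 := hv (f ∘ l.1) (AnalyticAt.comp (f := l.1) hf hl) ?_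
  · rw [fderiv_comp (f := l.1) x.1 hf.differentiableAt hl.differentiableAt] at h1
    exact h1
  · exact (tendsto_nhdsWithin_of_tendsto_nhds_of_eventually_within _
      (hl.continuousAt.tendsto.mono_left nhdsWithin_le_nhds)
      (eventually_nhdsWithin_of_forall fun y hy => S.mapsTo l.2 hy)).eventually h0

/-- The differential of an injection, as an isomorphism of tangent spaces. -/
noncomputable def tangentEquiv (l : S.Inj i j) (x : S.carrier i) : S.T i x ≃ₗ[ℂ] S.T j (app l x) :=
  LinearEquiv.ofInjectiveOfFinrankEq
    ((fderiv ℂ l.1 x.1 : Cn n →ₗ[ℂ] Cn n).restrict (fderiv_mem_T l x))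
    (fun v w h => Subtype.ext (S.injective_fderiv l.2 x.1 x.2 (congrArg Subtype.val h)))
    (by rw [finrank_T, finrank_T])

theorem coe_tangentEquiv (l : S.Inj i j) (x : S.carrier i) (v : S.T i x) :
    (tangentEquiv l x v : Cn n) = fderiv ℂ l.1 x.1 v.1 := rfl

/-- The differential of an injection, as an isomorphism of the ambient vector space. -/
noncomputable def ambientEquiv (l : S.Inj i j) (x : S.carrier i) : Cn n ≃ₗ[ℂ] Cn n :=
  LinearEquiv.ofInjectiveEndo (fderiv ℂ l.1 x.1 : Cn n →ₗ[ℂ] Cn n)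
    (S.injective_fderiv l.2 x.1 x.2)

theorem ambientEquiv_apply (l : S.Inj i j) (x : S.carrier i) (v : Cn n) :
    ambientEquiv l x v = fderiv ℂ l.1 x.1 v := rfl

theorem fderiv_comp_inj {k : S.Chart} (l : S.Inj i j) (l' : S.Inj j k) (x : S.carrier i)
    (v : Cn n) : fderiv ℂ (comp l l').1 x.1 v = fderiv ℂ l'.1 (app l x).1 (fderiv ℂ l.1 x.1 v) := by
  have h := fderiv_comp x.1 (S.holomorphic l'.2 _ (app l x).2).differentiableAt
    (S.holomorphic l.2 x.1 x.2).differentiableAt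
  exact congrArg (fun A : Cn n →L[ℂ] Cn n => A v) h

end ChartSystem
namespace LineOrbibundle

variable {n d : ℕ} {S : ChartSystem.{u} n d}

/-- `e` is a local holomorphic frame of the line orbibundle near `x`. -/
def IsFrame (L : LineOrbibundle S) (i : S.Chart) (x : S.carrier i) (e : ∀ y, L.Fiber i y) : Prop :=
  (∀ᶠ y in 𝓝 x, e y ≠ 0 ∧ ∀ v : L.Fiber i y, ∃ a : ℂ, v = a • e y) ∧
    ∀ᶠ y in 𝓝 x, ∀ σ : ∀ y, L.Fiber i y,
      L.IsHol i y σ ↔ ∃ u, S.HolFun i y u ∧ ∀ᶠ z in 𝓝 y, σ z = u z • e z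

theorem IsFrame.isHol {L : LineOrbibundle S} {i : S.Chart} {x : S.carrier i}
    {e : ∀ y, L.Fiber i y} (h : L.IsFrame i x e) : L.IsHol i x e :=
  (h.2.self_of_nhds e).2 ⟨fun _ => 1, .const 1, Eventually.of_forall fun _ => (one_smul _ _).symm⟩

theorem IsFrame.eventually {L : LineOrbibundle S} {i : S.Chart} {x : S.carrier i}
    {e : ∀ y, L.Fiber i y} (h : L.IsFrame i x e) : ∀ᶠ y in 𝓝 x, L.IsFrame i y e := by
  filter_upwards [eventually_eventually_nhds.2 h.1, eventually_eventually_nhds.2 h.2] with y h1 h2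
  exact ⟨h1, h2⟩

/-- A functional that takes the value one on a given non-zero vector. -/
theorem exists_dual_eq_one {V : Type} [AddCommGroup V] [Module ℂ V] (v : V) :
    ∃ φ : Module.Dual ℂ V, v ≠ 0 → φ v = 1 := by
  by_cases hv : v = 0
  · exact ⟨0, fun h => absurd hv h⟩
  · obtain ⟨φ, hφ⟩ := Module.Projective.exists_dual_eq_one ℂ hv
    exact ⟨φ, fun _ => hφ⟩

/-- The dual `-L` of a line orbibundle `L`, with the inverse transposed bundle maps. A section is
holomorphic if its pairings with the holomorphic sections of `L` are holomorphic functions. -/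
noncomputable def dual (L : LineOrbibundle S) : LineOrbibundle S where
  Fiber i x := Module.Dual ℂ (L.Fiber i x)
  IsHol i x σ := ∀ᶠ y in 𝓝 x, ∀ τ : ∀ y, L.Fiber i y, L.IsHol i y τ →
    S.HolFun i y (fun z => σ z (τ z))
  pull l x := (L.pull l x).symm.dualMap
  exists_frame i x := by
    obtain ⟨e, he⟩ : ∃ e, L.IsFrame i x e := L.exists_frame i x
    choose e' he' using fun y => exists_dual_eq_one (e y)
    refine ⟨e', ?_, ?_⟩
    · filter_upwards [he.1] with y hy
      refine ⟨fun h => ?_, fun φ => ⟨φ (e y), LinearMap.ext fun v => ?_⟩⟩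
      · have := he' y hy.1
        rw [h] at this
        simp at this
      · obtain ⟨a, rfl⟩ := hy.2 v
        simp [he' y hy.1, mul_comm]
    · filter_upwards [he.eventually] with y hy σ
      constructor
      · intro h
        refine ⟨fun z => σ z (e z), h.self_of_nhds e hy.isHol, ?_⟩
        filter_upwards [hy.1] with z hz
        refine LinearMap.ext fun v => ?_
        obtain ⟨a, rfl⟩ := hz.2 v
        simp [he' z hz.1, mul_comm]
      · rintro ⟨u, hu, hσ⟩
        filter_upwards [hy.eventually, hu.eventually, eventually_eventually_nhds.2 hσ]
          with z hz huz hσz τ hτ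
        obtain ⟨w, hw, hτw⟩ := (hz.2.self_of_nhds τ).1 hτ
        refine (huz.mul hw).congr ?_
        filter_upwards [hσz, hτw, hz.1] with t h1 h2 h3
        rw [h1, h2]
        simp [he' t h3.1, mul_comm]
  pull_comp l l' x φ := by
    refine LinearMap.ext fun v => ?_
    obtain ⟨w, rfl⟩ := (L.pull (ChartSystem.comp l l') x).surjective v
    have h := L.pull_comp l l' x w
    simp only [LinearEquiv.dualMap_apply, LinearEquiv.symm_apply_apply]
    rw [h, LinearEquiv.symm_apply_apply, LinearEquiv.symm_apply_apply]
  isHol_pull {i j} l x σ hσ := by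
    filter_upwards [(ChartSystem.continuousAt_app l x).eventually
      (eventually_eventually_nhds.2 hσ)] with y hy τ hτ
    obtain ⟨e, he⟩ : ∃ e, L.IsFrame j (ChartSystem.app l y) e := L.exists_frame j _
    obtain ⟨f, hf⟩ : ∃ f, L.IsFrame i y f := L.exists_frame i y
    obtain ⟨u, hu, hτu⟩ := (hf.2.self_of_nhds τ).1 hτ
    obtain ⟨w, hw, hew⟩ := (hf.2.self_of_nhds _).1 (L.isHol_pull l y e he.isHol)
    have hw0 : w y ≠ 0 := by
      intro h0
      have h1 := hew.self_of_nhds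
      rw [h0, zero_smul, LinearEquiv.map_eq_zero_iff] at h1
      exact he.1.self_of_nhds.1 h1
    have h2 := (hy.self_of_nhds e he.isHol).comp_app
    refine ((hu.mul (hw.inv hw0)).mul h2).congr ?_
    have hw0' : ∀ᶠ z in 𝓝 y, w z ≠ 0 := by
      obtain ⟨g, hg, hwg⟩ := hw
      have : g y.1 ≠ 0 := by rwa [← hwg.self_of_nhds]
      filter_upwards [hwg, continuousAt_subtype_val.eventually
        (hg.continuousAt.eventually_ne this)] with z h3 h4
      rwa [h3]
    filter_upwards [hτu, hew, hw0'] with z h3 h4 h5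
    have h6 : τ z = L.pull l z ((u z * (w z)⁻¹) • e (ChartSystem.app l z)) := by
      rw [map_smul, h4, h3, smul_smul, inv_mul_cancel_right₀ h5]
    rw [LinearEquiv.dualMap_apply, h6, LinearEquiv.symm_apply_apply, map_smul, smul_eq_mul]

/-- The `k`-fold tensor power `kL` of a line orbibundle `L`. -/
noncomputable def pow (k : ℕ) (L : LineOrbibundle S) : LineOrbibundle S where
  Fiber i x := PiTensorProduct ℂ fun _ : Fin k => L.Fiber i x
  IsHol i x σ := ∃ (u : S.carrier i → ℂ) (τ : Fin k → ∀ y, L.Fiber i y),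
    S.HolFun i x u ∧ (∀ a, L.IsHol i x (τ a)) ∧
      ∀ᶠ y in 𝓝 x, σ y = u y • PiTensorProduct.tprod ℂ fun a => τ a y
  pull l x := PiTensorProduct.congr fun _ => L.pull l x
  exists_frame i x := by
    obtain ⟨e, he⟩ : ∃ e, L.IsFrame i x e := L.exists_frame i x
    have key : ∀ y, (∀ v : L.Fiber i y, ∃ a : ℂ, v = a • e y) → ∀ t : Fin k → L.Fiber i y,
        ∀ c : Fin k → ℂ, (∀ a, t a = c a • e y) → PiTensorProduct.tprod ℂ t
          = (∏ a, c a) • PiTensorProduct.tprod ℂ fun _ : Fin k => e y := by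
      intro y _ t c hc
      rw [← MultilinearMap.map_smul_univ]
      exact congrArg _ (funext hc)
    refine ⟨fun y => PiTensorProduct.tprod ℂ fun _ => e y, ?_, ?_⟩
    · filter_upwards [he.1] with y hy
      constructor
      · intro h0
        obtain ⟨φ, hφ⟩ := exists_dual_eq_one (e y)
        have h1 := congrArg (PiTensorProduct.lift ((MultilinearMap.mkPiAlgebra ℂ (Fin k) ℂ).compLinearMap
          fun _ => φ)) h0
        simp [hφ hy.1] at h1
      · intro v
        induction v using PiTensorProduct.induction_on with
        | smul_tprod r t =>
          choose c hc using fun a => hy.2 (t a)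
          exact ⟨r * ∏ a, c a, by rw [key y hy.2 t c hc, smul_smul]⟩
        | add v w hv hw =>
          obtain ⟨a, rfl⟩ := hv
          obtain ⟨b, rfl⟩ := hw
          exact ⟨a + b, (add_smul _ _ _).symm⟩
    · filter_upwards [he.eventually] with y hy σ
      constructor
      · rintro ⟨u, τ, hu, hτ, hσ⟩
        choose w hw hτw using fun a => (hy.2.self_of_nhds (τ a)).1 (hτ a)
        refine ⟨fun z => u z * ∏ a, w a z, hu.mul (.prod hw), ?_⟩
        filter_upwards [hσ, eventually_all.2 hτw, hy.1] with z h1 h2 h3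
        rw [h1, key z h3.2 _ _ h2, smul_smul]
      · rintro ⟨u, hu, hσ⟩
        exact ⟨u, fun _ => e, hu, fun _ => hy.isHol, hσ⟩
  pull_comp l l' x v := by
    induction v using PiTensorProduct.induction_on with
    | smul_tprod r t =>
      simp only [map_smul, PiTensorProduct.congr_tprod]
      refine congrArg (fun s => r • PiTensorProduct.tprod ℂ s)
        (funext fun a : Fin k => (?_ : _ = (_ : L.Fiber _ x)))
      exact L.pull_comp l l' x (t a)
    | add v w hv hw => simp only [map_add, hv, hw]
  isHol_pull l x σ := by
    rintro ⟨u, τ, hu, hτ, hσ⟩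
    refine ⟨_, fun a y => L.pull l y (τ a (ChartSystem.app l y)), hu.comp_app,
      fun a => L.isHol_pull l x (τ a) (hτ a), ?_⟩
    filter_upwards [(ChartSystem.continuousAt_app l x).eventually hσ] with y hy
    rw [hy, map_smul, PiTensorProduct.congr_tprod]

/-- The line orbibundle with trivial bundles over the charts and bundle maps given by multiplication
with nowhere vanishing holomorphic functions `ξ λ` that satisfy the cocycle condition. -/
noncomputable def ofCocycle (ξ : ∀ {i j}, S.Inj i j → S.carrier i → ℂ)
    (h_hol : ∀ {i j} (l : S.Inj i j) (x : S.carrier i), S.HolFun i x (ξ l))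
    (h_ne : ∀ {i j} (l : S.Inj i j) (x : S.carrier i), ξ l x ≠ 0)
    (h_comp : ∀ {i j k} (l : S.Inj i j) (l' : S.Inj j k) (x : S.carrier i),
      ξ (ChartSystem.comp l l') x = ξ l x * ξ l' (ChartSystem.app l x)) : LineOrbibundle S where
  Fiber _ _ := ℂ
  IsHol i x σ := S.HolFun i x σ
  pull l x := LinearEquiv.smulOfNeZero ℂ ℂ (ξ l x) (h_ne l x)
  exists_frame i x := by
    refine ⟨fun _ => 1, Eventually.of_forall fun y => ⟨one_ne_zero, fun v => ⟨v, by simp⟩⟩,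
      Eventually.of_forall fun y σ => ⟨fun h => ⟨σ, h, by simp⟩, ?_⟩⟩
    rintro ⟨u, hu, hσ⟩
    exact hu.congr (by simpa using hσ)
  pull_comp l l' x v := by
    simp [LinearEquiv.smulOfNeZero_apply, h_comp, mul_assoc]
  isHol_pull l x σ hσ := (h_hol l x).mul hσ.comp_app

end LineOrbibundle
/-! ### The canonical and the conormal orbibundle -/

theorem analyticAt_form {n k : ℕ} {x : Cn n} (η : Cn n → Cn n [⋀^Fin k]→ₗ[ℂ] ℂ)
    (hη : ∀ v, AnalyticAt ℂ (fun y => η y v) x) (a : Fin k → Cn n → Cn n)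
    (ha : ∀ j, AnalyticAt ℂ (a j) x) : AnalyticAt ℂ (fun y => η y fun j => a j y) x := by
  have h : (fun y => η y fun j => a j y) = fun y => ∑ r : Fin k → Fin n,
      (∏ j, a j y (r j)) * η y fun j => Pi.basisFun ℂ (Fin n) (r j) := by
    funext y
    have h1 : (fun j => a j y) = fun j => ∑ p, a j y p • Pi.basisFun ℂ (Fin n) p := by
      funext j
      exact ((Pi.basisFun ℂ (Fin n)).sum_repr (a j y)).symm
    rw [h1, ← AlternatingMap.coe_multilinearMap, MultilinearMap.map_sum]
    exact Finset.sum_congr rfl fun r _ => by rw [MultilinearMap.map_smul_univ, smul_eq_mul]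
  rw [h]
  refine Finset.analyticAt_fun_sum _ fun r _ => ?_
  refine (Finset.analyticAt_fun_prod _ fun j _ => ?_).mul (hη _)
  exact ((ContinuousLinearMap.proj (R := ℂ) (φ := fun _ : Fin n => ℂ) (r j)).analyticAt _).comp (ha j)

theorem analyticAt_functional {n : ℕ} {x : Cn n} (ξ : Cn n → Module.Dual ℂ (Cn n))
    (hξ : ∀ v, AnalyticAt ℂ (fun y => ξ y v) x) (a : Cn n → Cn n)
    (ha : AnalyticAt ℂ a x) : AnalyticAt ℂ (fun y => ξ y (a y)) x := by
  have h : (fun y => ξ y (a y)) = fun y => ∑ p, a y p * ξ y (Pi.basisFun ℂ (Fin n) p) := by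
    funext y
    conv_lhs => rw [← (Pi.basisFun ℂ (Fin n)).sum_repr (a y)]
    rw [map_sum]
    exact Finset.sum_congr rfl fun r _ => by rw [map_smul, smul_eq_mul]; rfl
  rw [h]
  refine Finset.analyticAt_fun_sum _ fun p _ => AnalyticAt.mul ?_ (hξ _)
  exact ((ContinuousLinearMap.proj (R := ℂ) (φ := fun _ : Fin n => ℂ) p).analyticAt _).comp ha

theorem analyticAt_fderiv_apply {n : ℕ} {F : Type} [NormedAddCommGroup F] [NormedSpace ℂ F]
    [CompleteSpace F] {x : Cn n} {f : Cn n → F} (hf : AnalyticAt ℂ f x) (v : Cn n) :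
    AnalyticAt ℂ (fun y => fderiv ℂ f y v) x :=
  ((ContinuousLinearMap.apply ℂ F v).analyticAt _).comp hf.fderiv

/-- Top-degree forms on a space with a given basis are proportional. -/
theorem form_smul_comm {d : ℕ} {V : Type} [AddCommGroup V] [Module ℂ V]
    (b : Module.Basis (Fin d) ℂ V) (f g : V [⋀^Fin d]→ₗ[ℂ] ℂ) : g b • f = f b • g := by
  rw [f.eq_smul_basis_det b, g.eq_smul_basis_det b]
  simp only [AlternatingMap.smul_apply, smul_smul, smul_eq_mul]
  ring_nf

/-- A basis of a submodule made of vectors of the ambient space. -/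
theorem exists_basis_of_span_eq {n d : ℕ} {W : Submodule ℂ (Cn n)} {t : Fin d → Cn n}
    (h : LinearIndependent ℂ t) (h' : Submodule.span ℂ (Set.range t) = W) :
    ∃ b : Module.Basis (Fin d) ℂ W, ∀ k, (b k : Cn n) = t k := by
  subst h'
  exact ⟨Module.Basis.span h, fun k => congrArg Subtype.val (Module.Basis.span_apply h k)⟩

/-- The functional `v ↦ det (v, t_1, …, t_m)` on `ℂᵐ⁺¹`. -/
noncomputable def detFunctional {m : ℕ} (t : Fin m → Cn (m + 1)) : Module.Dual ℂ (Cn (m + 1)) where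
  toFun v := (Pi.basisFun ℂ (Fin (m + 1))).det.curryLeft v t
  map_add' v w := by simp
  map_smul' a v := by simp

theorem detFunctional_apply {m : ℕ} (t : Fin m → Cn (m + 1)) (v : Cn (m + 1)) :
    detFunctional t v = (Pi.basisFun ℂ (Fin (m + 1))).det (Fin.cons v t) := rfl

theorem detFunctional_spec {m : ℕ} {W : Submodule ℂ (Cn (m + 1))} {t : Fin m → Cn (m + 1)}
    (h : LinearIndependent ℂ t) (h' : Submodule.span ℂ (Set.range t) = W) :
    detFunctional t ∈ W.dualAnnihilator ∧ detFunctional t ≠ 0 ∧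
      LinearMap.ker (detFunctional t) = W := by
  have hW : Module.finrank ℂ W = m := by rw [← h', finrank_span_eq_card h, Fintype.card_fin]
  have h1 : detFunctional t ∈ W.dualAnnihilator := by
    rw [Submodule.mem_dualAnnihilator]
    intro w hw
    have hle : W ≤ LinearMap.ker (detFunctional t) := by
      rw [← h', Submodule.span_le]
      rintro _ ⟨k, rfl⟩
      rw [SetLike.mem_coe, LinearMap.mem_ker, detFunctional_apply]
      exact AlternatingMap.map_eq_zero_of_eq _ _ (i := 0) (j := k.succ) (by simp)
        (Fin.succ_ne_zero k).symm
    exact hle hw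
  have h2 : detFunctional t ≠ 0 := by
    intro h0
    have hlt : W ≠ ⊤ := by
      rintro rfl
      rw [finrank_top, Module.finrank_fin_fun] at hW
      omega
    obtain ⟨v, -, hv⟩ := SetLike.exists_of_lt (lt_top_iff_ne_top.2 hlt)
    have hli : LinearIndependent ℂ (Fin.cons v t : Fin (m + 1) → Cn (m + 1)) :=
      linearIndependent_finCons.2 ⟨h, by rwa [h']⟩
    let b := basisOfLinearIndependentOfCardEqFinrank hli (by simp)
    have hb := (Pi.basisFun ℂ (Fin (m + 1))).isUnit_det b
    rw [show (b : Fin (m + 1) → Cn (m + 1)) = Fin.cons v t from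
      coe_basisOfLinearIndependentOfCardEqFinrank _ _, ← detFunctional_apply, h0] at hb
    simp at hb
  refine ⟨h1, h2, (Submodule.eq_of_le_of_finrank_eq ?_ ?_).symm⟩
  · exact fun w hw => (Submodule.mem_dualAnnihilator _).1 h1 w hw
  · have := Module.Dual.finrank_ker_add_one_of_ne_zero h2
    rw [Module.finrank_fin_fun] at this
    omega

namespace ChartSystem

variable {n d : ℕ}

/-- The canonical orbibundle `K`: its fibre at `x` consists of the alternating `d`-forms on the
tangent space (`d` being the dimension), the bundle maps are pull-backs of forms, and a section is
holomorphic if locally it is the restriction of a form with holomorphic coefficients on `ℂⁿ`. -/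
noncomputable def canonical (S : ChartSystem.{u} n d) : LineOrbibundle S where
  Fiber i x := (S.T i x) [⋀^Fin d]→ₗ[ℂ] ℂ
  IsHol i x σ := ∃ η : Cn n → Cn n [⋀^Fin d]→ₗ[ℂ] ℂ, (∀ v, AnalyticAt ℂ (fun y => η y v) x.1) ∧
    ∀ᶠ y in 𝓝 x, ∀ t : Fin d → S.T i y, σ y t = η y.1 fun k => (t k).1
  pull l x := AlternatingMap.domLCongr ℂ ℂ (Fin d) ℂ (tangentEquiv l x).symm
  exists_frame i x := by
    obtain ⟨τ, hτ, hfr⟩ := S.exists_frame i x.1 x.2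
    obtain ⟨hx1, hx2⟩ := hfr.self_of_nhdsWithin x.2
    obtain ⟨P, hP⟩ := LinearMap.exists_leftInverse_of_injective
      (Fintype.linearCombination ℂ fun k => τ k x.1)
      (LinearMap.ker_eq_bot.2 hx1.fintypeLinearCombination_injective)
    let η₀ : Cn n [⋀^Fin d]→ₗ[ℂ] ℂ := (Pi.basisFun ℂ (Fin d)).det.compLinearMap P
    have hη₀ : η₀ (fun k => τ k x.1) = 1 := by
      have : (fun k => P (τ k x.1)) = Pi.basisFun ℂ (Fin d) := by
        funext k
        have h1 := LinearMap.congr_fun hP (Pi.single k 1)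
        simpa [Fintype.linearCombination_apply_single] using h1
      change (Pi.basisFun ℂ (Fin d)).det (fun k => P (τ k x.1)) = 1
      rw [this, Module.Basis.det_self]
    have hw : ∀ y : Cn n, (∀ k, AnalyticAt ℂ (τ k) y) →
        AnalyticAt ℂ (fun z => η₀ fun k => τ k z) y := fun y hy =>
      analyticAt_form (fun _ => η₀) (fun _ => analyticAt_const) τ hy
    have hgood : ∀ᶠ y in 𝓝 x, (LinearIndependent ℂ (fun k => τ k y.1) ∧
        Submodule.span ℂ (Set.range fun k => τ k y.1) = S.T i y) ∧
        η₀ (fun k => τ k y.1) ≠ 0 := by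
      refine Eventually.and ?_ ?_
      · rw [← map_nhds_subtype_val] at hfr
        exact hfr
      · refine continuousAt_subtype_val.eventually
          ((hw x.1 hτ).continuousAt.eventually_ne ?_)
        rw [hη₀]
        exact one_ne_zero
    have hkey : ∀ y : S.carrier i, ((LinearIndependent ℂ (fun k => τ k y.1) ∧
        Submodule.span ℂ (Set.range fun k => τ k y.1) = S.T i y) ∧
        η₀ (fun k => τ k y.1) ≠ 0) → ∃ t : Fin d → S.T i y, (∀ k, (t k).1 = τ k y.1) ∧
        ∀ f : (S.T i y) [⋀^Fin d]→ₗ[ℂ] ℂ,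
          f = (f t / η₀ fun k => τ k y.1) • η₀.compLinearMap (S.T i y).subtype := by
      rintro y ⟨⟨h1, h2⟩, h3⟩
      obtain ⟨b, hb⟩ := exists_basis_of_span_eq h1 h2
      refine ⟨b, hb, fun f => ?_⟩
      have h4 := form_smul_comm b f (η₀.compLinearMap (S.T i y).subtype)
      have h5 : (η₀.compLinearMap (S.T i y).subtype) b = η₀ fun k => τ k y.1 :=
        congrArg η₀ (funext hb)
      rw [h5] at h4
      rw [div_eq_inv_mul, mul_smul, ← h4, smul_smul, inv_mul_cancel₀ h3, one_smul]
    refine ⟨fun y => η₀.compLinearMap (S.T i y).subtype, ?_, ?_⟩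
    · filter_upwards [hgood] with y hy
      obtain ⟨t, ht, hf⟩ := hkey y hy
      refine ⟨fun h0 => hy.2 ?_, fun f => ⟨_, hf f⟩⟩
      have : (η₀.compLinearMap (S.T i y).subtype) t = 0 := by rw [h0]; rfl
      rw [← this]
      exact congrArg η₀ (funext fun k => (ht k).symm)
    · filter_upwards [eventually_eventually_nhds.2 hgood, eventually_all.2 fun k =>
        continuousAt_subtype_val.eventually (hτ k).eventually_analyticAt] with y hy hτy σ
      constructor
      · rintro ⟨η, hη, hσ⟩
        refine ⟨fun z => (η z.1 fun k => τ k z.1) / η₀ fun k => τ k z.1,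
          ⟨fun z => (η z fun k => τ k z) / η₀ fun k => τ k z,
            (analyticAt_form η hη τ hτy).div (hw y.1 hτy) hy.self_of_nhds.2,
            Eventually.of_forall fun _ => rfl⟩, ?_⟩
        filter_upwards [hσ, hy] with z h1 h2
        obtain ⟨t, ht, hf⟩ := hkey z h2
        rw [← funext ht, ← h1 t, funext ht]
        exact hf (σ z)
      · rintro ⟨u, ⟨f, hf, huf⟩, hσ⟩
        refine ⟨fun z => f z • η₀, fun v => hf.mul analyticAt_const, ?_⟩
        filter_upwards [huf, hσ] with z h1 h2 t
        rw [h2, h1]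
        rfl
  pull_comp l l' x f := by
    refine AlternatingMap.ext fun t => congrArg f (funext fun k => Subtype.ext ?_)
    exact fderiv_comp_inj l l' x (t k)
  isHol_pull {i j} l x σ := by
    rintro ⟨η, hη, hσ⟩
    have hl := S.holomorphic l.2 x.1 x.2
    refine ⟨fun y => (η (l.1 y)).compLinearMap (fderiv ℂ l.1 y : Cn n →ₗ[ℂ] Cn n), fun v => ?_, ?_⟩
    · refine analyticAt_form (fun y => η (l.1 y)) (fun w => ?_) (fun k y => fderiv ℂ l.1 y (v k))
        fun k => analyticAt_fderiv_apply hl (v k)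
      exact AnalyticAt.comp (f := l.1) (g := fun y => η y w) (hη w) hl
    · filter_upwards [(continuousAt_app l x).eventually hσ] with y hy t
      exact hy fun k => tangentEquiv l y (t k)

/-- The value of an element of a fibre of the canonical orbibundle (an alternating form) on tangent
vectors. -/
def evalForm {S : ChartSystem.{u} n d} {i : S.Chart} {x : S.carrier i} (f : S.canonical.Fiber i x)
    (t : Fin d → S.T i x) : ℂ :=
  (show (S.T i x) [⋀^Fin d]→ₗ[ℂ] ℂ from f) t

/-- The conormal orbibundle `N^*` of a hypersurface: its fibre at `x` consists of the functionals on
the ambient tangent space `ℂᵐ⁺¹` that vanish on the tangent space of the hypersurface, the bundle maps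
are pull-backs, and a section is holomorphic if locally it is the restriction of a `1`-form with
holomorphic coefficients on `ℂᵐ⁺¹`. -/
noncomputable def conormal {m : ℕ} (S : ChartSystem.{u} (m + 1) m) : LineOrbibundle S where
  Fiber i x := (S.T i x).dualAnnihilator
  IsHol i x σ := ∃ ξ : Cn (m + 1) → Module.Dual ℂ (Cn (m + 1)),
    (∀ v, AnalyticAt ℂ (fun y => ξ y v) x.1) ∧
    ∀ᶠ y in 𝓝 x, (σ y : Module.Dual ℂ (Cn (m + 1))) = ξ y.1
  pull {i j} l x :=
    { toFun := fun ξ => ⟨ξ.1 ∘ₗ (ambientEquiv l x : Cn (m + 1) →ₗ[ℂ] Cn (m + 1)), by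
        rw [Submodule.mem_dualAnnihilator]
        exact fun w hw => (Submodule.mem_dualAnnihilator _).1 ξ.2 _ (fderiv_mem_T l x w hw)⟩
      invFun := fun ξ => ⟨ξ.1 ∘ₗ ((ambientEquiv l x).symm : Cn (m + 1) →ₗ[ℂ] Cn (m + 1)), by
        rw [Submodule.mem_dualAnnihilator]
        intro w hw
        obtain ⟨v, hv⟩ := (tangentEquiv l x).surjective ⟨w, hw⟩
        have h1 : ambientEquiv l x v.1 = w := congrArg Subtype.val hv
        have h2 : (ambientEquiv l x).symm w = v.1 := by rw [← h1, LinearEquiv.symm_apply_apply]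
        rw [LinearMap.comp_apply, LinearEquiv.coe_coe, h2]
        exact (Submodule.mem_dualAnnihilator _).1 ξ.2 _ v.2⟩
      left_inv := fun ξ => Subtype.ext <| LinearMap.ext fun v =>
        congrArg ξ.1 ((ambientEquiv l x).apply_symm_apply v)
      right_inv := fun ξ => Subtype.ext <| LinearMap.ext fun v =>
        congrArg ξ.1 ((ambientEquiv l x).symm_apply_apply v)
      map_add' := fun _ _ => rfl
      map_smul' := fun _ _ => rfl }
  exists_frame i x := by
    obtain ⟨τ, hτ, hfr⟩ := S.exists_frame i x.1 x.2
    have hgood : ∀ᶠ y in 𝓝 x, LinearIndependent ℂ (fun k => τ k y.1) ∧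
        Submodule.span ℂ (Set.range fun k => τ k y.1) = S.T i y := by
      rw [← map_nhds_subtype_val] at hfr
      exact hfr
    have hφ : ∀ y : Cn (m + 1), (∀ k, AnalyticAt ℂ (τ k) y) → ∀ v,
        AnalyticAt ℂ (fun z => detFunctional (fun k => τ k z) v) y := fun y hy v => by
      have h := analyticAt_form (fun _ => (Pi.basisFun ℂ (Fin (m + 1))).det)
        (fun _ => analyticAt_const) (Fin.cons (fun _ => v) τ)
        (Fin.cases analyticAt_const hy)
      refine h.congr (Eventually.of_forall fun z => ?_)
      change _ = (Pi.basisFun ℂ (Fin (m + 1))).det (Fin.cons v fun k => τ k z)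
      exact congrArg _ (funext fun k => Fin.cases rfl (fun _ => rfl) k)
    have hex : ∀ y : S.carrier i, ∃ e : (S.T i y).dualAnnihilator,
        (LinearIndependent ℂ (fun k => τ k y.1) ∧
          Submodule.span ℂ (Set.range fun k => τ k y.1) = S.T i y) →
        e.1 = detFunctional fun k => τ k y.1 := by
      intro y
      by_cases h : LinearIndependent ℂ (fun k => τ k y.1) ∧
          Submodule.span ℂ (Set.range fun k => τ k y.1) = S.T i y
      · exact ⟨⟨_, (detFunctional_spec h.1 h.2).1⟩, fun _ => rfl⟩
      · exact ⟨0, fun h' => absurd h' h⟩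
    choose e he using hex
    have hkey : ∀ y : S.carrier i, (LinearIndependent ℂ (fun k => τ k y.1) ∧
        Submodule.span ℂ (Set.range fun k => τ k y.1) = S.T i y) →
        ∀ v, detFunctional (fun k => τ k y.1) v ≠ 0 → ∀ ξ : (S.T i y).dualAnnihilator,
          ξ = (ξ.1 v / detFunctional (fun k => τ k y.1) v) • e y := by
      intro y hy v hv ξ
      refine Subtype.ext (LinearMap.ext fun w => ?_)
      change ξ.1 w = _ * (e y).1 w
      rw [he y hy]
      have h1 : w - (detFunctional (fun k => τ k y.1) w / detFunctional (fun k => τ k y.1) v) • v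
          ∈ S.T i y := by
        rw [← (detFunctional_spec hy.1 hy.2).2.2, LinearMap.mem_ker, map_sub, map_smul, smul_eq_mul,
          div_mul_cancel₀ _ hv, sub_self]
      have h2 := (Submodule.mem_dualAnnihilator _).1 ξ.2 _ h1
      rw [map_sub, map_smul, smul_eq_mul, sub_eq_zero] at h2
      rw [h2]
      ring
    have hne : ∀ y : S.carrier i, (LinearIndependent ℂ (fun k => τ k y.1) ∧
        Submodule.span ℂ (Set.range fun k => τ k y.1) = S.T i y) →
        ∃ v, detFunctional (fun k => τ k y.1) v ≠ 0 := by
      intro y hy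
      by_contra! h
      exact (detFunctional_spec hy.1 hy.2).2.1 (LinearMap.ext h)
    refine ⟨e, ?_, ?_⟩
    · filter_upwards [hgood] with y hy
      refine ⟨fun h0 => (detFunctional_spec hy.1 hy.2).2.1 ?_, fun ξ => ?_⟩
      · rw [← he y hy, h0]
        rfl
      · obtain ⟨v, hv⟩ := hne y hy
        exact ⟨_, hkey y hy v hv ξ⟩
    · filter_upwards [eventually_eventually_nhds.2 hgood, eventually_all.2 fun k =>
        continuousAt_subtype_val.eventually (hτ k).eventually_analyticAt] with y hy hτy σ
      constructor
      · rintro ⟨ξ, hξ, hσ⟩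
        obtain ⟨v, hv⟩ := hne y hy.self_of_nhds
        refine ⟨fun z => ξ z.1 v / detFunctional (fun k => τ k z.1) v,
          ⟨fun z => ξ z v / detFunctional (fun k => τ k z) v,
            (hξ v).div (hφ y.1 hτy v) hv, Eventually.of_forall fun _ => rfl⟩, ?_⟩
        filter_upwards [hσ, hy, continuousAt_subtype_val.eventually
          ((hφ y.1 hτy v).continuousAt.eventually_ne hv)] with z h1 h2 h3
        rw [← h1]
        exact hkey z h2 v h3 (σ z)
      · rintro ⟨u, ⟨f, hf, huf⟩, hσ⟩
        refine ⟨fun z => f z • detFunctional fun k => τ k z, fun v => hf.mul (hφ y.1 hτy v), ?_⟩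
        filter_upwards [huf, hσ, hy] with z h1 h2 h3
        rw [h2, h1, ← he z h3]
        rfl
  pull_comp l l' x ξ := by
    refine Subtype.ext (LinearMap.ext fun v => congrArg ξ.1 ?_)
    exact fderiv_comp_inj l l' x v
  isHol_pull {i j} l x σ := by
    rintro ⟨ξ, hξ, hσ⟩
    have hl := S.holomorphic l.2 x.1 x.2
    refine ⟨fun y => ξ (l.1 y) ∘ₗ (fderiv ℂ l.1 y : Cn (m + 1) →ₗ[ℂ] Cn (m + 1)), fun v => ?_, ?_⟩
    · refine analyticAt_functional (fun y => ξ (l.1 y)) (fun w => ?_) (fun y => fderiv ℂ l.1 y v)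
        (analyticAt_fderiv_apply hl v)
      exact AnalyticAt.comp (f := l.1) (g := fun y => ξ y w) (hξ w) hl
    · filter_upwards [(continuousAt_app l x).eventually hσ] with y hy
      exact congrArg (fun ζ => ζ ∘ₗ (fderiv ℂ l.1 y.1 : Cn (m + 1) →ₗ[ℂ] Cn (m + 1))) hy

end ChartSystem
/-! ### The charts of `X` and of `D`, the bundle `[D]`, and volume forms with poles -/

theorem tangent_mono {n : ℕ} {M N : Set (Cn n)} (h : M ⊆ N) (x : Cn n) :
    tangent M x ≤ tangent N x :=
  fun _ hv f hf h0 => hv f hf (h0.filter_mono (nhdsWithin_mono x h))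

theorem tangent_of_isOpen {n : ℕ} {M : Set (Cn n)} (h : IsOpen M) {x : Cn n} (hx : x ∈ M) :
    tangent M x = ⊤ := by
  refine eq_top_iff.2 fun v _ f _ h0 => ?_
  rw [h.nhdsWithin_eq hx] at h0
  have h1 : f =ᶠ[𝓝 x] fun _ => 0 := h0
  rw [h1.fderiv_eq]
  simp

/-- The tangent space of a smooth hypersurface is the kernel of the differential of a defining
function. -/
theorem tangent_preimage {X : Type u} [TopologicalSpace X] {n : ℕ} {c : OrbiChart X n} {D : Set X}
    {s : Cn n → ℂ} (hs : IsDefiningFunction c D s) {x : Cn n} (hx : x ∈ c.preimage D) :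
    tangent (c.preimage D) x = LinearMap.ker (fderiv ℂ s x : Cn n →ₗ[ℂ] ℂ) := by
  have hsx := hs.holomorphic x hx.1
  refine le_antisymm (fun v hv => ?_) fun v hv f hf h0 => ?_
  · exact hv s hsx (eventually_nhdsWithin_of_forall fun y hy => (hs.zero_iff y hy.1).2 hy.2)
  · have hstrict := hsx.hasStrictFDerivAt
    have hrange : (fderiv ℂ s x : Cn n →ₗ[ℂ] ℂ).range = ⊤ := by
      refine LinearMap.range_eq_top.2 (LinearMap.surjective ?_)
      intro h1
      exact hs.fderiv_ne_zero x hx (ContinuousLinearMap.coe_injective h1)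
    let g := HasStrictFDerivAt.implicitFunction s (fderiv ℂ s x) hstrict hrange (s x)
    have hg : HasStrictFDerivAt g (fderiv ℂ s x : Cn n →ₗ[ℂ] ℂ).ker.subtypeL 0 :=
      hstrict.to_implicitFunction hrange
    have hsx0 : s x = 0 := (hs.zero_iff x hx.1).2 hx.2
    have hg0 : g 0 = x := hstrict.implicitFunction_apply_image hrange
    have hgs : ∀ᶠ w in 𝓝 (0 : (fderiv ℂ s x : Cn n →ₗ[ℂ] ℂ).ker), s (g w) = s x := by
      have h1 := hstrict.map_implicitFunction_eq hrange
      have h2 : Tendsto (fun w : (fderiv ℂ s x : Cn n →ₗ[ℂ] ℂ).ker => (s x, w)) (𝓝 0)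
          (𝓝 (s x, 0)) := (Continuous.prodMk_right (s x)).tendsto' _ _ rfl
      exact h2.eventually h1
    have hgc : Tendsto g (𝓝 0) (𝓝 x) := by
      have := hg.continuousAt.tendsto
      rwa [hg0] at this
    have hfg : (f ∘ g) =ᶠ[𝓝 0] fun _ => 0 := by
      filter_upwards [hgs, hgc.eventually (c.isOpen_dom.mem_nhds hx.1),
        hgc.eventually (eventually_nhdsWithin_iff.1 h0)] with w h1 h2 h3
      exact h3 ⟨h2, (hs.zero_iff _ h2).1 (h1.trans hsx0)⟩
    have h4 : HasFDerivAt (f ∘ g) ((fderiv ℂ f x).comp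
        (fderiv ℂ s x : Cn n →ₗ[ℂ] ℂ).ker.subtypeL) 0 := by
      refine HasFDerivAt.comp 0 ?_ hg.hasFDerivAt
      rw [hg0]
      exact hf.differentiableAt.hasFDerivAt
    have h5 := h4.fderiv
    rw [hfg.fderiv_eq] at h5
    have h6 := congrArg (fun A => A (⟨v, hv⟩ : (fderiv ℂ s x : Cn n →ₗ[ℂ] ℂ).ker)) h5
    simpa using h6.symm

/-- The zero set of a defining function has dense complement. -/
theorem IsDefiningFunction.frequently_ne_zero {X : Type u} [TopologicalSpace X] {n : ℕ}
    {c : OrbiChart X n} {D : Set X} {s : Cn n → ℂ} (hs : IsDefiningFunction c D s) {x : Cn n}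
    (hx : x ∈ c.dom) : ∃ᶠ y in 𝓝 x, s y ≠ 0 := by
  intro h
  have h1 : s =ᶠ[𝓝 x] fun _ => 0 := by
    filter_upwards [h] with y hy
    exact not_not.1 hy
  refine hs.fderiv_ne_zero x ⟨hx, (hs.zero_iff x hx).1 h1.self_of_nhds⟩ ?_
  rw [h1.fderiv_eq]
  simp

/-- The orbifold `X`, described by its atlas of charts on which `D` has a defining function. -/
def ComplexOrbifold.ambientSystem {X : Type u} [TopologicalSpace X] {n : ℕ}
    (O : ComplexOrbifold X n) (D : Set X) : ChartSystem.{max u 1} n n where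
  Chart := O.DivisorChart D
  carrier c := c.1.dom
  Inj c c' := {l | IsInjection c.1 c'.1 l}
  mapsTo h := IsInjection.mapsTo h
  holomorphic h := IsInjection.holomorphic h
  injective_fderiv h := IsInjection.injective_fderiv h
  comp_mem h h' := IsInjection.comp h h'
  exists_frame c x hx := by
    refine ⟨fun k _ => Pi.basisFun ℂ (Fin n) k, fun k => analyticAt_const,
      eventually_nhdsWithin_of_forall fun y hy => ⟨(Pi.basisFun ℂ (Fin n)).linearIndependent, ?_⟩⟩
    rw [tangent_of_isOpen c.1.isOpen_dom hy]
    exact (Pi.basisFun ℂ (Fin n)).span_eq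

/-- The orbifold `D`, described by its atlas induced from `X`: the charts are the preimages
`D̃ ⊆ Ũ` of `D`, with the same local uniformising groups and injections. -/
def ComplexOrbifold.suborbifoldSystem {X : Type u} [TopologicalSpace X] {m : ℕ}
    (O : ComplexOrbifold X (m + 1)) (D : Set X) : ChartSystem.{max u 1} (m + 1) m where
  Chart := O.DivisorChart D
  carrier c := c.1.preimage D
  Inj c c' := {l | IsInjection c.1 c'.1 l}
  mapsTo h x hx := by
    refine ⟨IsInjection.mapsTo h hx.1, ?_⟩
    rw [IsInjection.proj_comp h x hx.1]
    exact hx.2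
  holomorphic h x hx := IsInjection.holomorphic h x hx.1
  injective_fderiv h x hx := IsInjection.injective_fderiv h x hx.1
  comp_mem h h' := IsInjection.comp h h'
  exists_frame c x hx := by
    obtain ⟨s, hs⟩ := c.2.2
    have hsx := hs.holomorphic x hx.1
    obtain ⟨v, hv⟩ : ∃ v, fderiv ℂ s x v ≠ 0 := by
      by_contra! h
      exact hs.fderiv_ne_zero x hx (ContinuousLinearMap.ext h)
    have hrank : ∀ y ∈ c.1.preimage D,
        Module.finrank ℂ (LinearMap.ker (fderiv ℂ s y : Cn (m + 1) →ₗ[ℂ] ℂ)) = m := by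
      intro y hy
      have := Module.Dual.finrank_ker_add_one_of_ne_zero (K := ℂ)
        (f := (fderiv ℂ s y : Cn (m + 1) →ₗ[ℂ] ℂ))
        fun h => hs.fderiv_ne_zero y hy (ContinuousLinearMap.coe_injective h)
      rw [Module.finrank_fin_fun] at this
      omega
    let b := Module.finBasisOfFinrankEq ℂ _ (hrank x hx)
    refine ⟨fun k y => (b k).1 - (fderiv ℂ s y (b k).1 / fderiv ℂ s y v) • v, fun k => ?_, ?_⟩
    · exact analyticAt_const.sub (((analyticAt_fderiv_apply hsx _).div
        (analyticAt_fderiv_apply hsx v) hv).smul analyticAt_const)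
    · filter_upwards [self_mem_nhdsWithin, nhdsWithin_le_nhds
        ((analyticAt_fderiv_apply hsx v).continuousAt.eventually_ne hv)] with y hy hyv
      have hli : LinearIndependent ℂ fun k =>
          (b k).1 - (fderiv ℂ s y (b k).1 / fderiv ℂ s y v) • v := by
        rw [Fintype.linearIndependent_iff]
        intro a ha
        have h1 : ∑ k, a k • (b k).1
            = (∑ k, a k * (fderiv ℂ s y (b k).1 / fderiv ℂ s y v)) • v := by
          rw [Finset.sum_smul, ← sub_eq_zero, ← Finset.sum_sub_distrib, ← ha]
          exact Finset.sum_congr rfl fun k _ => by rw [smul_sub, smul_smul]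
        have h2 : fderiv ℂ s x (∑ k, a k • (b k).1) = 0 := by
          rw [map_sum]
          refine Finset.sum_eq_zero fun k _ => ?_
          have : fderiv ℂ s x (b k).1 = 0 := (b k).2
          rw [map_smul, this, smul_zero]
        have h3 : ∑ k, a k * (fderiv ℂ s y (b k).1 / fderiv ℂ s y v) = 0 := by
          rw [h1, map_smul, smul_eq_mul] at h2
          exact (mul_eq_zero.1 h2).resolve_right hv
        rw [h3, zero_smul] at h1
        refine Fintype.linearIndependent_iff.1 b.linearIndependent a (Subtype.ext ?_)
        simpa using h1
      refine ⟨hli, ?_⟩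
      rw [tangent_preimage hs hy]
      refine Submodule.eq_of_le_of_finrank_eq ?_ ?_
      · rw [Submodule.span_le]
        rintro _ ⟨k, rfl⟩
        change fderiv ℂ s y _ = 0
        rw [map_sub, map_smul, smul_eq_mul, div_mul_cancel₀ _ hyv, sub_self]
      · rw [finrank_span_eq_card hli, hrank y hy, Fintype.card_fin]

/-- Defining functions `f` of `D` on the charts together with the nowhere vanishing holomorphic
functions `ξ λ = f_i / (f_j ∘ λ)` for the injections `λ` from the chart `i` to the chart `j`. -/
structure ComplexOrbifold.DivisorData {X : Type u} [TopologicalSpace X] {n : ℕ}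
    (O : ComplexOrbifold X n) (D : Set X) where
  f : O.DivisorChart D → Cn n → ℂ
  isDefining : ∀ c, IsDefiningFunction c.1 D (f c)
  ξ : ∀ {c c' : O.DivisorChart D}, (O.ambientSystem D).Inj c c' →
    (O.ambientSystem D).carrier c → ℂ
  ξ_hol : ∀ {c c' : O.DivisorChart D} (l : (O.ambientSystem D).Inj c c')
    (x : (O.ambientSystem D).carrier c), (O.ambientSystem D).HolFun c x (ξ l)
  ξ_ne_zero : ∀ {c c' : O.DivisorChart D} (l : (O.ambientSystem D).Inj c c')
    (x : (O.ambientSystem D).carrier c), ξ l x ≠ 0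
  f_eq : ∀ {c c' : O.DivisorChart D} (l : (O.ambientSystem D).Inj c c')
    (x : (O.ambientSystem D).carrier c), f c x.1 = ξ l x * f c' (l.1 x.1)

/-- The line orbibundle `[D]` of the Baily divisor `D`, given by the cocycle `ξ`; the functions `f`
are its defining section. -/
noncomputable def ComplexOrbifold.DivisorData.lineOrbibundle {X : Type u} [TopologicalSpace X]
    {n : ℕ} {O : ComplexOrbifold X n} {D : Set X} (Z : O.DivisorData D) :
    LineOrbibundle (O.ambientSystem D) :=
  LineOrbibundle.ofCocycle Z.ξ Z.ξ_hol Z.ξ_ne_zero <| by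
    intro c c' c'' l l' x
    have hfreq := (Z.isDefining c).frequently_ne_zero (x := x.1) x.2
    have hmap : map Subtype.val (𝓝 x) = 𝓝 x.1 := by
      rw [map_nhds_subtype_val]
      exact c.1.isOpen_dom.nhdsWithin_eq x.2
    have hfreq' : ∃ᶠ y in 𝓝 x, Z.f c y.1 ≠ 0 := by
      rw [← hmap] at hfreq
      exact hfreq
    obtain ⟨g, hg, h1⟩ := Z.ξ_hol (ChartSystem.comp l l') x
    obtain ⟨h, hh, h2⟩ := (Z.ξ_hol l x).mul
      (ChartSystem.HolFun.comp_app (Z.ξ_hol l' (ChartSystem.app l x)))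
    have hgh : g x.1 = h x.1 := by
      by_contra hne
      have h3 : ∀ᶠ y in 𝓝 x.1, g y - h y ≠ 0 :=
        (hg.sub hh).continuousAt.eventually_ne (sub_ne_zero.2 hne)
      obtain ⟨y, hy0, hy1, hy2, hy3⟩ := (hfreq'.and_eventually
        (h1.and (h2.and (continuousAt_subtype_val.eventually h3)))).exists
      have e1 := Z.f_eq (ChartSystem.comp l l') y
      have e2 := Z.f_eq l y
      have e3 := Z.f_eq l' (ChartSystem.app l y)
      have hk : Z.f c'' (l'.1 (l.1 y.1)) ≠ 0 := fun h0 => hy0 (by rw [e1, h0, mul_zero])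
      refine hy3 (sub_eq_zero.2 ?_)
      rw [← hy1, ← hy2]
      refine mul_right_cancel₀ hk ?_
      rw [← e1, e2, e3, mul_assoc]
    exact h1.self_of_nhds.trans (hgh.trans h2.self_of_nhds.symm)

/-- The canonical orbibundle `K_X` of `X`. -/
noncomputable abbrev ComplexOrbifold.canonicalX {X : Type u} [TopologicalSpace X] {n : ℕ}
    (O : ComplexOrbifold X n) (D : Set X) : LineOrbibundle (O.ambientSystem D) :=
  (O.ambientSystem D).canonical

/-- The canonical orbibundle `K_D` of `D`. -/
noncomputable abbrev ComplexOrbifold.canonicalD {X : Type u} [TopologicalSpace X] {m : ℕ}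
    (O : ComplexOrbifold X (m + 1)) (D : Set X) : LineOrbibundle (O.suborbifoldSystem D) :=
  (O.suborbifoldSystem D).canonical

/-- The conormal orbibundle `N_D^*` of `D` in `X`. -/
noncomputable abbrev ComplexOrbifold.conormalD {X : Type u} [TopologicalSpace X] {m : ℕ}
    (O : ComplexOrbifold X (m + 1)) (D : Set X) : LineOrbibundle (O.suborbifoldSystem D) :=
  (O.suborbifoldSystem D).conormal

/-- `-K_X = α[D]` as line orbibundles on `X`. -/
def ComplexOrbifold.AnticanonicalEq {X : Type u} [TopologicalSpace X] {n : ℕ}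
    (O : ComplexOrbifold X n) (D : Set X) (α : ℕ) : Prop :=
  ∃ Z : O.DivisorData D, Nonempty ((O.canonicalX D).dual.Iso (Z.lineOrbibundle.pow α))

/-- A family of `(m + 1)`-forms `Ω` on the charts `Ũ` of `X`, `dim X = m + 1`. -/
abbrev ComplexOrbifold.FormFamily {X : Type u} [TopologicalSpace X] {m : ℕ}
    (O : ComplexOrbifold X (m + 1)) (D : Set X) : Type (max u 1) :=
  ∀ (c : O.DivisorChart D) (x : (O.ambientSystem D).carrier c),
    ((O.ambientSystem D).T c x) [⋀^Fin (m + 1)]→ₗ[ℂ] ℂ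

/-- `Ω` is a trivialising (that is, holomorphic and nowhere vanishing) section of `K_{X∖D}` that, as a
section of `K_X`, blows up to order `α` along `D`: on each chart `s^α Ω` extends to a nowhere
vanishing holomorphic form, `s` being a defining function of `D`. The values of `Ω` along `D` are
irrelevant. -/
structure ComplexOrbifold.IsVolumeFormWithPole {X : Type u} [TopologicalSpace X] {m : ℕ}
    (O : ComplexOrbifold X (m + 1)) (D : Set X) (α : ℕ) (Ω : O.FormFamily D) : Prop where
  holomorphic : ∀ c (x : (O.ambientSystem D).carrier c), c.1.proj x.1 ∉ D →
    (O.canonicalX D).IsHol c x (Ω c)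
  ne_zero : ∀ c (x : (O.ambientSystem D).carrier c), c.1.proj x.1 ∉ D → Ω c x ≠ 0
  pull_eq : ∀ c c' (l : (O.ambientSystem D).Inj c c') (x : (O.ambientSystem D).carrier c),
    c.1.proj x.1 ∉ D → (O.canonicalX D).pull l x (Ω c' (ChartSystem.app l x)) = Ω c x
  pole : ∀ c, ∃ s, IsDefiningFunction c.1 D s ∧
    ∃ η : ∀ x : (O.ambientSystem D).carrier c,
        ((O.ambientSystem D).T c x) [⋀^Fin (m + 1)]→ₗ[ℂ] ℂ,
      (∀ x, (O.canonicalX D).IsHol c x η ∧ η x ≠ 0) ∧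
      ∀ x, c.1.proj x.1 ∉ D → η x = s x.1 ^ α • Ω c x

/-- The isomorphism `ψ : (α - 1) N_D^* ≅ K_D` is given by the Poincaré residue of `Ω`: on each chart,
for each defining function `s` of `D` and each holomorphic extension `η` of `s^α Ω`, it maps
`ds^{⊗(α-1)}` at `z ∈ D̃` to the restriction to `T_z D̃` of the contraction `η ⌟ v = η(v, ·)`, where `v`
is any vector with `ds(v) = 1` (a representative of `∂/∂s` in the normal space). -/
def ComplexOrbifold.IsPoincareResidue {X : Type u} [TopologicalSpace X] {m : ℕ}
    (O : ComplexOrbifold X (m + 1)) (D : Set X) (α : ℕ) (Ω : O.FormFamily D)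
    (ψ : ((O.conormalD D).pow (α - 1)).Iso (O.canonicalD D)) : Prop :=
  ∀ (c : O.DivisorChart D) (s : Cn (m + 1) → ℂ), IsDefiningFunction c.1 D s →
    ∀ η : ∀ x : (O.ambientSystem D).carrier c,
      ((O.ambientSystem D).T c x) [⋀^Fin (m + 1)]→ₗ[ℂ] ℂ,
    (∀ x, (O.canonicalX D).IsHol c x η) →
    (∀ x, c.1.proj x.1 ∉ D → η x = s x.1 ^ α • Ω c x) →
    ∀ (z : (O.suborbifoldSystem D).carrier c) (ν : ((O.suborbifoldSystem D).T c z).dualAnnihilator),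
    (∀ w, ν.1 w = fderiv ℂ s z.1 w) →
    ∀ v : (O.ambientSystem D).T c ⟨z.1, z.2.1⟩, fderiv ℂ s z.1 v.1 = 1 →
    ∀ t : Fin m → (O.suborbifoldSystem D).T c z,
      ChartSystem.evalForm (ψ.equiv c z (PiTensorProduct.tprod ℂ
          (s := fun _ : Fin (α - 1) => ((O.suborbifoldSystem D).T c z).dualAnnihilator) fun _ => ν)) t
        = η ⟨z.1, z.2.1⟩
          (Fin.cons v fun k => Submodule.inclusion (tangent_mono (fun _ h => h.1) z.1) (t k))

end OrbiAdj

/-! Nowhere vanishing holomorphic sections over the charts reduce the comparison of line orbibundles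
to a comparison of cocycles. Let `f` be the local equations of `D`, with cocycle `ξ = f_i / (f_j ∘
l)`. The isomorphism `-K_X ≅ α[D]` carries the sections `1^{⊗α}` of `α[D]` to sections of `-K_X`;
the dual sections of `K_X` are nowhere vanishing top-degree forms that transform by `ξ^{-α}`
(`LineOrbibundle.exists_sections_of_dual_iso`). Dividing them by `f^α` makes them invariant, and the
result is `Ω` (`AnticanonicalEq.exists_volumeForm`).

For the residue, let `η` extend `s^α Ω` over a chart. If `s'` is another defining function, then at
each point of `D̃` one has `ds' = a ds` for some number `a ≠ 0`. There the extension gets multiplied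
by `a^α` (`IsExtension.eq_pow_smul`), whereas the normal vector `v` with `ds(v) = 1` gets multiplied
by `a⁻¹`. Hence the residue scales by `a^(α-1)` (`residue_eq_pow_smul`), exactly as `ds^{⊗(α-1)}`
does.

Injections of charts bring in nothing new: `s ∘ l` is one more defining function on the source
chart, and residues and differentials commute with pull-back (`residue_pull`, `pull_conormalOf`).
The elements of the local groups are injections too, so equivariance is covered. Thus `ds^{⊗(α-1)}`
and the residue transform by the same cocycle, and `Iso.ofSections` matches them. Fibres being
lines, an isomorphism is determined by its values on these sections, which gives uniqueness. -/

namespace OrbiAdj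

/-! ### Local frames, and isomorphisms given by nowhere vanishing sections -/

namespace ChartSystem

variable {n d : ℕ} {S : ChartSystem.{u} n d} {i j : S.Chart}

theorem HolFun.eventually_ne {x : S.carrier i} {u : S.carrier i → ℂ} (h : S.HolFun i x u)
    (h0 : u x ≠ 0) : ∀ᶠ y in 𝓝 x, u y ≠ 0 := by
  obtain ⟨f, hf, hu⟩ := h
  have h1 : f x.1 ≠ 0 := by rwa [← hu.self_of_nhds]
  filter_upwards [hu, continuousAt_subtype_val.eventually (hf.continuousAt.eventually_ne h1)]
    with y h2 h3
  rwa [h2]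

end ChartSystem

namespace LineOrbibundle

variable {n d : ℕ} {S : ChartSystem.{u} n d} {i j : S.Chart}

theorem exists_isFrame (L : LineOrbibundle S) (i : S.Chart) (x : S.carrier i) :
    ∃ e, L.IsFrame i x e := L.exists_frame i x

/-- `IsHol` is an abstract predicate of the bundle. Its module structure over the holomorphic
functions, like its dependence on germs only, is recovered from the description of holomorphic
sections by a frame. -/
theorem IsHol.smul {L : LineOrbibundle S} {x : S.carrier i} {σ : ∀ y, L.Fiber i y}
    (hσ : L.IsHol i x σ) {u : S.carrier i → ℂ} (hu : S.HolFun i x u) :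
    L.IsHol i x (fun y => u y • σ y) := by
  obtain ⟨e, he⟩ := L.exists_isFrame i x
  obtain ⟨w, hw, h⟩ := (he.2.self_of_nhds σ).1 hσ
  refine (he.2.self_of_nhds _).2 ⟨_, hu.mul hw, ?_⟩
  filter_upwards [h] with y hy
  rw [hy, smul_smul]

theorem IsHol.congr {L : LineOrbibundle S} {x : S.carrier i} {σ τ : ∀ y, L.Fiber i y}
    (hσ : L.IsHol i x σ) (h : ∀ᶠ y in 𝓝 x, σ y = τ y) : L.IsHol i x τ := by
  obtain ⟨e, he⟩ := L.exists_isFrame i x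
  obtain ⟨w, hw, h1⟩ := (he.2.self_of_nhds σ).1 hσ
  refine (he.2.self_of_nhds _).2 ⟨_, hw, ?_⟩
  filter_upwards [h, h1] with y h2 h3
  rw [← h2, h3]

/-- A holomorphic section is a local frame near each point where it does not vanish. -/
theorem IsHol.isFrame {L : LineOrbibundle S} {x : S.carrier i} {σ : ∀ y, L.Fiber i y}
    (hσ : L.IsHol i x σ) (h0 : σ x ≠ 0) : L.IsFrame i x σ := by
  obtain ⟨e, he⟩ := L.exists_isFrame i x
  obtain ⟨w, hw, h1⟩ := (he.2.self_of_nhds σ).1 hσ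
  have hw0 : w x ≠ 0 := by
    intro h
    rw [h1.self_of_nhds, h, zero_smul] at h0
    exact h0 rfl
  have hne := hw.eventually_ne hw0
  constructor
  · filter_upwards [h1, hne, he.1] with y h2 h3 h4
    rw [h2]
    refine ⟨smul_ne_zero h3 h4.1, fun v => ?_⟩
    obtain ⟨a, rfl⟩ := h4.2 v
    exact ⟨a * (w y)⁻¹, by rw [smul_smul, inv_mul_cancel_right₀ h3]⟩
  -- Since `σ = w • e` with `w` invertible near `x`, coefficients with respect to `e` and to `σ`
  -- differ by the holomorphic unit `w`.
  · filter_upwards [eventually_eventually_nhds.2 h1, eventually_eventually_nhds.2 hne,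
      hw.eventually, he.eventually] with y h2 h3 h4 h5 τ
    rw [h5.2.self_of_nhds τ]
    constructor
    · rintro ⟨u, hu, h⟩
      refine ⟨_, hu.mul (h4.inv h3.self_of_nhds), ?_⟩
      filter_upwards [h, h2, h3] with z h6 h7 h8
      rw [h6, h7, smul_smul, inv_mul_cancel_right₀ h8]
    · rintro ⟨u, hu, h⟩
      refine ⟨_, hu.mul h4, ?_⟩
      filter_upwards [h, h2] with z h6 h7
      rw [h6, h7, smul_smul]

/-- A local frame spans the fibre at its base point, so every fibre is a line and any non-zero
vector of it is a generator. -/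
theorem exists_eq_smul (L : LineOrbibundle S) {x : S.carrier i} {e : L.Fiber i x} (he : e ≠ 0)
    (v : L.Fiber i x) : ∃ a : ℂ, v = a • e := by
  obtain ⟨f, hf⟩ := L.exists_isFrame i x
  obtain ⟨-, h⟩ := hf.1.self_of_nhds
  obtain ⟨a, rfl⟩ := h v
  obtain ⟨b, rfl⟩ := h e
  exact ⟨a * b⁻¹, by rw [smul_smul, inv_mul_cancel_right₀ (left_ne_zero_of_smul he)]⟩

/-- A non-zero vector of a fibre as a basis of the fibre. -/
noncomputable def spanEquiv {L : LineOrbibundle S} {x : S.carrier i} {e : L.Fiber i x}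
    (he : e ≠ 0) : ℂ ≃ₗ[ℂ] L.Fiber i x :=
  LinearEquiv.ofBijective (LinearMap.toSpanSingleton ℂ _ e)
    ⟨smul_left_injective ℂ he, fun v => (L.exists_eq_smul he v).imp fun _ h => h.symm⟩

theorem spanEquiv_one {L : LineOrbibundle S} {x : S.carrier i} {e : L.Fiber i x} (he : e ≠ 0) :
    spanEquiv he 1 = e :=
  one_smul ℂ e

/-- The linear isomorphism of two fibres that takes a given non-zero vector to another one. -/
noncomputable def fiberEquiv {L L' : LineOrbibundle S} {x : S.carrier i} {e : L.Fiber i x}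
    {e' : L'.Fiber i x} (he : e ≠ 0) (he' : e' ≠ 0) : L.Fiber i x ≃ₗ[ℂ] L'.Fiber i x :=
  (spanEquiv he).symm.trans (spanEquiv he')

theorem fiberEquiv_apply {L L' : LineOrbibundle S} {x : S.carrier i} {e : L.Fiber i x}
    {e' : L'.Fiber i x} (he : e ≠ 0) (he' : e' ≠ 0) : fiberEquiv he he' e = e' := by
  rw [fiberEquiv, LinearEquiv.trans_apply, (LinearEquiv.symm_apply_eq _).2 (spanEquiv_one he).symm,
    spanEquiv_one]

/-- Nowhere vanishing holomorphic sections over the charts that transform by the same cocycle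
define an isomorphism. -/
noncomputable def Iso.ofSections {L L' : LineOrbibundle S} (e : ∀ i y, L.Fiber i y)
    (e' : ∀ i y, L'.Fiber i y) (he : ∀ i y, L.IsHol i y (e i)) (he' : ∀ i y, L'.IsHol i y (e' i))
    (h0 : ∀ i y, e i y ≠ 0) (h0' : ∀ i y, e' i y ≠ 0)
    (h : ∀ {i j} (l : S.Inj i j) (x : S.carrier i), ∃ a : ℂ,
      L.pull l x (e j (ChartSystem.app l x)) = a • e i x ∧
      L'.pull l x (e' j (ChartSystem.app l x)) = a • e' i x) : L.Iso L' where
  equiv i x := fiberEquiv (h0 i x) (h0' i x)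
  isHol_iff i x σ := by
    rw [((he i x).isFrame (h0 i x)).2.self_of_nhds, ((he' i x).isFrame (h0' i x)).2.self_of_nhds]
    -- The coefficient of a section with respect to `e` is also the coefficient of its image with
    -- respect to `e'`, so the same `u` serves on both sides.
    refine exists_congr fun u => and_congr_right fun _ => eventually_congr <|
      Eventually.of_forall fun y => ?_
    rw [← (fiberEquiv (h0 i y) (h0' i y)).injective.eq_iff, map_smul, fiberEquiv_apply]
  pull_comm {i j} l x v := by
    obtain ⟨a, h1, h2⟩ := h l x
    obtain ⟨b, rfl⟩ := L.exists_eq_smul (h0 j _) v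
    simp only [map_smul, h1, fiberEquiv_apply, h2]

theorem Iso.ofSections_equiv {L L' : LineOrbibundle S} {e : ∀ i y, L.Fiber i y}
    {e' : ∀ i y, L'.Fiber i y} {he : ∀ i y, L.IsHol i y (e i)} {he' : ∀ i y, L'.IsHol i y (e' i)}
    {h0 : ∀ i y, e i y ≠ 0} {h0' : ∀ i y, e' i y ≠ 0}
    {h : ∀ {i j} (l : S.Inj i j) (x : S.carrier i), ∃ a : ℂ,
      L.pull l x (e j (ChartSystem.app l x)) = a • e i x ∧
      L'.pull l x (e' j (ChartSystem.app l x)) = a • e' i x} (i : S.Chart) (x : S.carrier i) :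
    (Iso.ofSections e e' he he' h0 h0' h).equiv i x (e i x) = e' i x :=
  fiberEquiv_apply (h0 i x) (h0' i x)

/-- Fibres are lines, so the linear maps are determined on one generator each; the remaining fields
of `Iso` are propositions. This is the source of uniqueness for the residue isomorphism. -/
theorem Iso.ext_of_sections {L L' : LineOrbibundle S} {ψ ψ' : L.Iso L'} (e : ∀ i y, L.Fiber i y)
    (h0 : ∀ i y, e i y ≠ 0) (h : ∀ i y, ψ.equiv i y (e i y) = ψ'.equiv i y (e i y)) : ψ = ψ' := by
  have h1 : ψ.equiv = ψ'.equiv := by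
    funext i x
    refine LinearEquiv.ext fun v => ?_
    obtain ⟨a, rfl⟩ := L.exists_eq_smul (h0 i x) v
    rw [map_smul, map_smul, h]
  cases ψ
  cases ψ'
  cases h1
  rfl

/-- The inverse of an isomorphism of line orbibundles. -/
def Iso.symm {L L' : LineOrbibundle S} (ψ : L.Iso L') : L'.Iso L where
  equiv i x := (ψ.equiv i x).symm
  isHol_iff i x σ := by simp [ψ.isHol_iff]
  pull_comm l x v := by
    rw [LinearEquiv.symm_apply_eq, ψ.pull_comm, LinearEquiv.apply_symm_apply]

theorem pull_smul (L : LineOrbibundle S) (l : S.Inj i j) (x : S.carrier i) (a : ℂ)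
    (v : L.Fiber j (ChartSystem.app l x)) : L.pull l x (a • v) = a • L.pull l x v :=
  map_smul _ _ _

theorem Iso.equiv_smul {L L' : LineOrbibundle S} (ψ : L.Iso L') (x : S.carrier i) (a : ℂ)
    (v : L.Fiber i x) : ψ.equiv i x (a • v) = a • ψ.equiv i x v :=
  map_smul _ _ _

/-! ### Tensor powers and dual sections -/

theorem isHol_tprod {L : LineOrbibundle S} {x : S.carrier i} {σ : ∀ y, L.Fiber i y} (k : ℕ)
    (hσ : L.IsHol i x σ) :
    (L.pow k).IsHol i x (fun y => PiTensorProduct.tprod ℂ fun _ : Fin k => σ y) :=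
  ⟨fun _ => 1, fun _ => σ, .const 1, fun _ => hσ, Eventually.of_forall fun _ => (one_smul _ _).symm⟩

/-- If `φ v = 1`, the functional induced by `φ ⊗ ⋯ ⊗ φ` and multiplication takes the value one on `v
⊗ ⋯ ⊗ v`. This includes the empty product `k = 0`. -/
theorem tprod_const_ne_zero {V : Type} [AddCommGroup V] [Module ℂ V] (k : ℕ) {v : V} (hv : v ≠ 0) :
    (PiTensorProduct.tprod ℂ fun _ : Fin k => v) ≠ 0 := by
  intro h0
  obtain ⟨φ, hφ⟩ := exists_dual_eq_one v
  have h1 := congrArg (PiTensorProduct.lift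
    ((MultilinearMap.mkPiAlgebra ℂ (Fin k) ℂ).compLinearMap fun _ => φ)) h0
  simp [hφ hv] at h1

theorem tprod_const_smul {V : Type} [AddCommGroup V] [Module ℂ V] (k : ℕ) (a : ℂ) (v : V) :
    (PiTensorProduct.tprod ℂ fun _ : Fin k => a • v)
      = a ^ k • PiTensorProduct.tprod ℂ fun _ : Fin k => v := by
  have h := (PiTensorProduct.tprod ℂ).map_smul_univ (fun _ : Fin k => a) (fun _ : Fin k => v)
  simpa using h

theorem pull_tprod {L : LineOrbibundle S} (k : ℕ) (l : S.Inj i j) (x : S.carrier i)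
    (v : L.Fiber j (ChartSystem.app l x)) :
    (L.pow k).pull l x (PiTensorProduct.tprod ℂ fun _ : Fin k => v)
      = PiTensorProduct.tprod ℂ fun _ : Fin k => L.pull l x v :=
  PiTensorProduct.congr_tprod _ _

/-- An isomorphism `-L ≅ M` turns nowhere vanishing holomorphic sections of `M` over the charts
into nowhere vanishing holomorphic sections of `L` that transform by the inverse cocycle. -/
theorem exists_sections_of_dual_iso {L M : LineOrbibundle S} (Φ : L.dual.Iso M)
    (e : ∀ i y, M.Fiber i y) (he : ∀ i y, M.IsHol i y (e i)) (h0 : ∀ i y, e i y ≠ 0) :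
    ∃ η : ∀ i y, L.Fiber i y, (∀ i y, L.IsHol i y (η i) ∧ η i y ≠ 0) ∧
      ∀ {i j} (l : S.Inj i j) (x : S.carrier i) (a : ℂ),
        M.pull l x (e j (ChartSystem.app l x)) = a • e i x →
        L.pull l x (η j (ChartSystem.app l x)) = a⁻¹ • η i x := by
  -- `δ` is the nowhere vanishing section of `-L` that corresponds to `e`, and `η` will be the
  -- section of `L` with `δ(η) = 1`.
  let δ : ∀ i y, Module.Dual ℂ (L.Fiber i y) := fun i y => (Φ.equiv i y).symm (e i y)
  have hδ0 : ∀ i y, δ i y ≠ 0 := fun i y h =>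
    h0 i y ((LinearEquiv.map_eq_zero_iff (Φ.equiv i y).symm).1 h)
  have hex : ∀ i y, ∃ v, δ i y v = 1 := fun i y => by
    obtain ⟨v, hv⟩ : ∃ v, δ i y v ≠ 0 := by
      by_contra! h
      exact hδ0 i y (LinearMap.ext h)
    exact ⟨(δ i y v)⁻¹ • v, by rw [map_smul, smul_eq_mul, inv_mul_cancel₀ hv]⟩
  choose η hη using hex
  have hη0 : ∀ i y, η i y ≠ 0 := fun i y h => by
    have := hη i y
    rw [h, map_zero] at this
    exact zero_ne_one this
  refine ⟨η, fun i x => ⟨?_, hη0 i x⟩, fun {i j} l x a ha => ?_⟩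
  -- For a local frame `f`, the function `δ(f)` is holomorphic by the definition of holomorphy in
  -- the dual. As `f = δ(f) • η`, the section `η = δ(f)⁻¹ • f` is holomorphic near `x`.
  · obtain ⟨f, hf⟩ := L.exists_isFrame i x
    have h1 : L.dual.IsHol i x (δ i) := (Φ.symm.isHol_iff i x _).1 (he i x)
    have h2 : S.HolFun i x fun y => δ i y (f y) := Eventually.self_of_nhds h1 f hf.isHol
    have h3 : ∀ y, f y = δ i y (f y) • η i y := fun y => by
      obtain ⟨a, ha⟩ := L.exists_eq_smul (hη0 i y) (f y)
      have h4 : δ i y (f y) = a := by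
        rw [ha, map_smul, hη, smul_eq_mul, mul_one]
      rw [h4, ← ha]
    have h5 : δ i x (f x) ≠ 0 := fun h => hf.1.self_of_nhds.1 (by rw [h3 x, h, zero_smul])
    refine (hf.isHol.smul (h2.inv h5)).congr ?_
    filter_upwards [h2.eventually_ne h5] with y hy
    conv_lhs => rw [h3 y]
    rw [map_smul, hη, smul_eq_mul, mul_one, smul_smul, inv_mul_cancel₀ hy, one_smul]
  · have h1 : L.dual.pull l x (δ j (ChartSystem.app l x)) = a • δ i x := by
      have := Φ.symm.pull_comm l x (e j (ChartSystem.app l x))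
      rw [ha, map_smul] at this
      exact this.symm
    obtain ⟨b, hb⟩ := L.exists_eq_smul (hη0 i x) (L.pull l x (η j (ChartSystem.app l x)))
    -- The bundle map of the dual is the inverse transpose. Evaluating the transformation rule of
    -- `δ` on the pulled-back `η`, which is `b • η i x`, gives `1 = a * b`.
    have h2 : δ j (ChartSystem.app l x)
        ((L.pull l x).symm (L.pull l x (η j (ChartSystem.app l x)))) = a * δ i x _ :=
      LinearMap.congr_fun h1 _
    rw [LinearEquiv.symm_apply_apply, hη, hb, map_smul, hη, smul_eq_mul, mul_one] at h2
    rw [hb, eq_inv_of_mul_eq_one_right h2.symm]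

end LineOrbibundle

/-! ### Differentials of defining functions along the hypersurface -/

section DefiningFunctions

variable {X : Type u} [TopologicalSpace X] {n : ℕ} {c c' : OrbiChart X n} {D : Set X}
  {s s' : Cn n → ℂ}

theorem IsDefiningFunction.exists_fderiv_eq_one (hs : IsDefiningFunction c D s) {x : Cn n}
    (hx : x ∈ c.preimage D) : ∃ v, fderiv ℂ s x v = 1 := by
  obtain ⟨v, hv⟩ : ∃ v, fderiv ℂ s x v ≠ 0 := by
    by_contra! h
    exact hs.fderiv_ne_zero x hx (ContinuousLinearMap.ext h)
  exact ⟨(fderiv ℂ s x v)⁻¹ • v, by rw [map_smul, smul_eq_mul, inv_mul_cancel₀ hv]⟩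

theorem IsDefiningFunction.mem_tangent_iff (hs : IsDefiningFunction c D s) {x : Cn n}
    (hx : x ∈ c.preimage D) {v : Cn n} :
    v ∈ tangent (c.preimage D) x ↔ fderiv ℂ s x v = 0 := by
  rw [tangent_preimage hs hx]
  rfl

/-- The differentials of two defining functions are proportional along the hypersurface. -/
theorem IsDefiningFunction.exists_fderiv_eq_smul (hs : IsDefiningFunction c D s)
    (hs' : IsDefiningFunction c D s') {x : Cn n} (hx : x ∈ c.preimage D) :
    ∃ a : ℂ, a ≠ 0 ∧ ∀ w, fderiv ℂ s' x w = a * fderiv ℂ s x w := by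
  obtain ⟨v, hv⟩ := hs.exists_fderiv_eq_one hx
  have h : ∀ w, fderiv ℂ s' x w = fderiv ℂ s' x v * fderiv ℂ s x w := by
    intro w
    -- The tangent space is the kernel of both differentials, so the `s`-tangential part of `w` is
    -- killed by `ds'` as well.
    have h1 : w - fderiv ℂ s x w • v ∈ tangent (c.preimage D) x := by
      rw [hs.mem_tangent_iff hx, map_sub, map_smul, hv, smul_eq_mul, mul_one, sub_self]
    rw [hs'.mem_tangent_iff hx, map_sub, map_smul, smul_eq_mul, sub_eq_zero] at h1
    rw [h1, mul_comm]
  refine ⟨_, fun h0 => hs'.fderiv_ne_zero x hx (ContinuousLinearMap.ext fun w => ?_), h⟩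
  rw [h, h0, zero_mul]
  rfl

theorem IsInjection.surjective_fderiv {l : Cn n → Cn n} (hl : IsInjection c c' l) {x : Cn n}
    (hx : x ∈ c.dom) : Function.Surjective (fderiv ℂ l x) :=
  LinearMap.injective_iff_surjective (f := (fderiv ℂ l x : Cn n →ₗ[ℂ] Cn n)).1
    (hl.injective_fderiv x hx)

theorem IsDefiningFunction.fderiv_comp_apply (hs : IsDefiningFunction c' D s) {l : Cn n → Cn n}
    (hl : IsInjection c c' l) {x : Cn n} (hx : x ∈ c.dom) (v : Cn n) :
    fderiv ℂ (s ∘ l) x v = fderiv ℂ s (l x) (fderiv ℂ l x v) := by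
  rw [fderiv_comp x (hs.holomorphic _ (hl.mapsTo hx)).differentiableAt
    (hl.holomorphic x hx).differentiableAt]
  rfl

/-- Defining functions pull back to defining functions under injections of charts. -/
theorem IsDefiningFunction.comp (hs : IsDefiningFunction c' D s) {l : Cn n → Cn n}
    (hl : IsInjection c c' l) : IsDefiningFunction c D (s ∘ l) where
  holomorphic x hx := (hs.holomorphic _ (hl.mapsTo hx)).comp (hl.holomorphic x hx)
  zero_iff x hx := by rw [Function.comp_apply, hs.zero_iff _ (hl.mapsTo hx), hl.proj_comp x hx]
  fderiv_ne_zero x hx h0 := by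
    have hlx : l x ∈ c'.preimage D := ⟨hl.mapsTo hx.1, by rw [hl.proj_comp x hx.1]; exact hx.2⟩
    obtain ⟨w, hw⟩ := hs.exists_fderiv_eq_one hlx
    obtain ⟨v, rfl⟩ := hl.surjective_fderiv hx.1 w
    rw [← hs.fderiv_comp_apply hl hx.1, h0] at hw
    exact zero_ne_one hw

end DefiningFunctions

/-! ### Extensions of `s^α Ω` across `D` -/

namespace ComplexOrbifold

variable {X : Type u} [TopologicalSpace X] {m : ℕ} {O : ComplexOrbifold X (m + 1)} {D : Set X}
  {α : ℕ}

/-- A family of top-degree forms on the tangent spaces of a chart of `X`. -/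
abbrev ChartForm (O : ComplexOrbifold X (m + 1)) (D : Set X) (c : O.DivisorChart D) : Type :=
  ∀ x : (O.ambientSystem D).carrier c, ((O.ambientSystem D).T c x) [⋀^Fin (m + 1)]→ₗ[ℂ] ℂ

/-- `η` is a holomorphic extension of `s^α Ω` to the whole chart. -/
structure IsExtension (α : ℕ) (Ω : O.FormFamily D) (c : O.DivisorChart D) (s : Cn (m + 1) → ℂ)
    (η : O.ChartForm D c) : Prop where
  isHol : ∀ x, (O.canonicalX D).IsHol c x η
  eq_smul : ∀ x, c.1.proj x.1 ∉ D → η x = s x.1 ^ α • Ω c x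

/-- Charts of `X` are open in `ℂᵐ⁺¹`, so a fixed vector may be used as a tangent vector at all
nearby points. -/
theorem mem_T_ambient {c : O.DivisorChart D} (x : (O.ambientSystem D).carrier c)
    (v : Cn (m + 1)) : v ∈ (O.ambientSystem D).T c x := by
  have h : (O.ambientSystem D).T c x = ⊤ := tangent_of_isOpen c.1.isOpen_dom x.2
  rw [h]
  trivial

/-- A point of the chart of `D`, as a point of the chart of `X`. -/
abbrev toAmbient {c : O.DivisorChart D} (z : (O.suborbifoldSystem D).carrier c) :
    (O.ambientSystem D).carrier c :=
  ⟨z.1, z.2.1⟩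

theorem continuous_toAmbient {c : O.DivisorChart D} :
    Continuous (toAmbient : (O.suborbifoldSystem D).carrier c → (O.ambientSystem D).carrier c) :=
  continuous_subtype_val.subtype_mk _

/-- The inclusion of the tangent space of `D` into the tangent space of `X`. -/
abbrev inclT {c : O.DivisorChart D} (z : (O.suborbifoldSystem D).carrier c) :
    (O.suborbifoldSystem D).T c z →ₗ[ℂ] (O.ambientSystem D).T c (toAmbient z) :=
  Submodule.inclusion (tangent_mono (fun _ h => h.1) z.1)

/-- Along `D`, the holomorphic extensions of `s^α Ω` and `s'^α Ω` differ by the factor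
`(ds' / ds)^α`. -/
theorem IsExtension.eq_pow_smul (hα : α ≠ 0) {Ω : O.FormFamily D} {c : O.DivisorChart D}
    {s s' : Cn (m + 1) → ℂ} {η η' : O.ChartForm D c} (hs : IsDefiningFunction c.1 D s)
    (hs' : IsDefiningFunction c.1 D s') (h : IsExtension α Ω c s η)
    (h' : IsExtension α Ω c s' η') (z : (O.suborbifoldSystem D).carrier c) {a : ℂ}
    (ha : ∀ w, fderiv ℂ s' z.1 w = a * fderiv ℂ s z.1 w) :
    η' (toAmbient z) = a ^ α • η (toAmbient z) := by
  refine AlternatingMap.ext fun t => ?_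
  obtain ⟨H, hH, hηH⟩ := h.isHol (toAmbient z)
  obtain ⟨H', hH', hηH'⟩ := h'.isHol (toAmbient z)
  have hz : s z.1 = 0 := (hs.zero_iff z.1 z.2.1).2 z.2.2
  have hz' : s' z.1 = 0 := (hs'.zero_iff z.1 z.2.1).2 z.2.2
  set w : Fin (m + 1) → Cn (m + 1) := fun k => (t k).1
  -- Off `D` both sides are `(s s')^α Ω(w)`; on `D` both vanish because `α ≠ 0`. The
  -- cross-multiplied form avoids having to write `s'` as a unit times `s`.
  have key : ∀ᶠ y in 𝓝 z.1, s y ^ α * H' y w = s' y ^ α * H y w := by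
    have h1 : ∀ᶠ y in 𝓝 (toAmbient z), s y.1 ^ α * H' y.1 w = s' y.1 ^ α * H y.1 w := by
      filter_upwards [hηH, hηH'] with y h2 h3
      by_cases hy : c.1.proj y.1 ∈ D
      · rw [(hs.zero_iff y.1 y.2).2 hy, (hs'.zero_iff y.1 y.2).2 hy, zero_pow hα, zero_mul,
          zero_mul]
      · have h4 := h2 fun k => ⟨w k, mem_T_ambient y _⟩
        have h5 := h3 fun k => ⟨w k, mem_T_ambient y _⟩
        rw [← h4, ← h5, h.eq_smul y hy, h'.eq_smul y hy, AlternatingMap.smul_apply,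
          AlternatingMap.smul_apply, smul_eq_mul, smul_eq_mul]
        ring
    have hmap : map Subtype.val (𝓝 (toAmbient z)) = 𝓝 z.1 := by
      rw [map_nhds_subtype_val]
      exact c.1.isOpen_dom.nhdsWithin_eq z.2.1
    rw [← hmap]
    exact h1
  -- Approach `z` along the transversal line `z + r v`. There `s / r → ds(v) = 1` and `s' / r →
  -- ds'(v) = a`, so multiplying `key` by `r^{-α}` and letting `r → 0` gives the claim.
  obtain ⟨v, hv⟩ := hs.exists_fderiv_eq_one z.2
  have hline : HasDerivAt (fun r : ℂ => z.1 + r • v) v 0 := by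
    simpa using ((hasDerivAt_id (0 : ℂ)).smul_const v).const_add z.1
  have hline0 : Tendsto (fun r : ℂ => z.1 + r • v) (𝓝[≠] 0) (𝓝 z.1) := by
    have := hline.continuousAt.tendsto.mono_left (nhdsWithin_le_nhds (s := {0}ᶜ))
    simpa using this
  have hslope : ∀ f : Cn (m + 1) → ℂ, AnalyticAt ℂ f z.1 → f z.1 = 0 →
      Tendsto (fun r : ℂ => r⁻¹ * f (z.1 + r • v)) (𝓝[≠] 0) (𝓝 (fderiv ℂ f z.1 v)) := by
    intro f hf hf0
    have h1 : HasFDerivAt f (fderiv ℂ f z.1) (z.1 + (0 : ℂ) • v) := by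
      simpa using hf.differentiableAt.hasFDerivAt
    have h2 := hasDerivAt_iff_tendsto_slope.1 (h1.comp_hasDerivAt (0 : ℂ) hline)
    refine h2.congr fun r => ?_
    simp [slope_def_field, hf0, div_eq_inv_mul]
  have l1 := ((hslope s (hs.holomorphic z.1 z.2.1) hz).pow α).mul
    ((hH' w).continuousAt.tendsto.comp hline0)
  have l2 := ((hslope s' (hs'.holomorphic z.1 z.2.1) hz').pow α).mul
    ((hH w).continuousAt.tendsto.comp hline0)
  have l3 := tendsto_nhds_unique (l1.congr' ?_) l2
  · rw [hv, ha, hv, one_pow, one_mul, mul_one] at l3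
    rw [AlternatingMap.smul_apply, hηH.self_of_nhds t, hηH'.self_of_nhds t, smul_eq_mul]
    exact l3
  · filter_upwards [hline0.eventually key] with r hr
    simp only [Function.comp_apply, mul_pow, mul_assoc, hr]

/-! ### The Poincaré residue on a chart -/

/-- The Poincaré residue at `z ∈ D̃` of `η / s^α`: the restriction of `η ⌟ v` to the tangent space of
`D`, where `ds(v) = 1`. -/
noncomputable def residue {c : O.DivisorChart D} {s : Cn (m + 1) → ℂ}
    (hs : IsDefiningFunction c.1 D s) (η : O.ChartForm D c)
    (z : (O.suborbifoldSystem D).carrier c) :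
    ((O.suborbifoldSystem D).T c z) [⋀^Fin m]→ₗ[ℂ] ℂ :=
  ((η (toAmbient z)).curryLeft ⟨(hs.exists_fderiv_eq_one z.2).choose, mem_T_ambient _ _⟩)
    |>.compLinearMap (inclT z)

/-- The residue does not depend on the vector `v` with `ds(v) = 1`. -/
theorem residue_apply {c : O.DivisorChart D} {s : Cn (m + 1) → ℂ}
    (hs : IsDefiningFunction c.1 D s) (η : O.ChartForm D c)
    (z : (O.suborbifoldSystem D).carrier c) (v : (O.ambientSystem D).T c (toAmbient z))
    (hv : fderiv ℂ s z.1 v.1 = 1) (t : Fin m → (O.suborbifoldSystem D).T c z) :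
    residue hs η z t = η (toAmbient z) (Fin.cons v fun k => inclT z (t k)) := by
  obtain ⟨v₀, hv₀, h0⟩ : ∃ v₀ : (O.ambientSystem D).T c (toAmbient z), fderiv ℂ s z.1 v₀.1 = 1 ∧
      residue hs η z t = (η (toAmbient z)).curryLeft v₀ fun k => inclT z (t k) :=
    ⟨⟨_, mem_T_ambient _ _⟩, (hs.exists_fderiv_eq_one z.2).choose_spec, rfl⟩
  have h1 : v₀.1 - v.1 ∈ (O.suborbifoldSystem D).T c z := by
    refine (hs.mem_tangent_iff z.2).2 ?_
    rw [map_sub, hv₀, hv, sub_self]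
  have h2 : v₀ = v + inclT z ⟨_, h1⟩ := Subtype.ext (by simp)
  -- Two choices of `v` differ by a vector tangent to `D̃`, and `m + 1` vectors of the
  -- `m`-dimensional tangent space are linearly dependent.
  have h3 : (η (toAmbient z)).curryLeft (inclT z ⟨_, h1⟩) (fun k => inclT z (t k)) = 0 := by
    change η (toAmbient z) (Fin.cons (inclT z ⟨_, h1⟩) fun k => inclT z (t k)) = 0
    have h4 : (Fin.cons (inclT z ⟨_, h1⟩) fun k => inclT z (t k) :
        Fin (m + 1) → (O.ambientSystem D).T c (toAmbient z))
        = fun k => inclT z ((Fin.cons ⟨_, h1⟩ t : Fin (m + 1) → _) k) :=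
      funext fun k => Fin.cases rfl (fun _ => rfl) k
    rw [h4]
    refine AlternatingMap.map_linearDependent _ _ fun hli => ?_
    have hli' := LinearIndependent.of_comp (inclT z) hli
    have h5 := hli'.fintype_card_le_finrank.trans_eq
      (ChartSystem.finrank_T (S := O.suborbifoldSystem D) z)
    rw [Fintype.card_fin] at h5
    omega
  rw [h0, h2, map_add, AlternatingMap.add_apply, h3, add_zero]
  rfl

/-- A vector `v` with `ds(v) = 1` is transversal to `D̃`, so it completes a basis of the tangent
space of `D̃` to one of the ambient space. A top-degree form that vanishes on a basis is zero. -/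
theorem residue_ne_zero {c : O.DivisorChart D} {s : Cn (m + 1) → ℂ}
    (hs : IsDefiningFunction c.1 D s) (η : O.ChartForm D c)
    (z : (O.suborbifoldSystem D).carrier c) (h0 : η (toAmbient z) ≠ 0) : residue hs η z ≠ 0 := by
  intro h
  obtain ⟨v, hv⟩ := hs.exists_fderiv_eq_one z.2
  let b : Module.Basis (Fin m) ℂ ((O.suborbifoldSystem D).T c z) :=
    Module.finBasisOfFinrankEq ℂ _ (ChartSystem.finrank_T z)
  let v' : (O.ambientSystem D).T c (toAmbient z) := ⟨v, mem_T_ambient _ _⟩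
  have hli : LinearIndependent ℂ (Fin.cons v' fun k => inclT z (b k) :
      Fin (m + 1) → (O.ambientSystem D).T c (toAmbient z)) := by
    refine linearIndependent_finCons.2 ⟨?_, fun hmem => ?_⟩
    · exact b.linearIndependent.map' (inclT z) (LinearMap.ker_eq_bot.2
        (Submodule.inclusion_injective _))
    · have hle : Submodule.span ℂ (Set.range fun k => inclT z (b k)) ≤ LinearMap.range (inclT z) := by
        rw [Submodule.span_le]
        rintro _ ⟨k, rfl⟩
        exact ⟨_, rfl⟩
      obtain ⟨w, hw⟩ := hle hmem
      have h1 : w.1 = v := congrArg Subtype.val hw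
      have h2 := (hs.mem_tangent_iff z.2).1 w.2
      rw [h1, hv] at h2
      exact one_ne_zero h2
  let B := basisOfLinearIndependentOfCardEqFinrank hli 
    ((Fintype.card_fin _).trans
      (ChartSystem.finrank_T (S := O.ambientSystem D) (i := c) (toAmbient z)).symm)
  refine h0 (((η (toAmbient z)).map_basis_eq_zero_iff B).1 ?_)
  rw [coe_basisOfLinearIndependentOfCardEqFinrank, ← residue_apply hs η z v' hv, h]
  rfl

/-- The residue of a holomorphic form is holomorphic. -/
theorem isHol_residue {c : O.DivisorChart D} {s : Cn (m + 1) → ℂ}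
    (hs : IsDefiningFunction c.1 D s) (η : O.ChartForm D c)
    (z : (O.suborbifoldSystem D).carrier c) (hη : (O.canonicalX D).IsHol c (toAmbient z) η) :
    (O.canonicalD D).IsHol c z (residue hs η) := by
  obtain ⟨H, hH, hηH⟩ := hη
  obtain ⟨v, hv⟩ := hs.exists_fderiv_eq_one z.2
  have hd := analyticAt_fderiv_apply (hs.holomorphic z.1 z.2.1) v
  have hd0 : fderiv ℂ s z.1 v ≠ 0 := by
    rw [hv]
    exact one_ne_zero
  -- The vectors chosen pointwise in `residue` need not vary holomorphically. Rescaling the fixed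
  -- `v` gives a holomorphic field with `ds = 1` near `z`, and `residue_apply` permits its use
  -- instead.
  refine ⟨fun y => (H y).curryLeft ((fderiv ℂ s y v)⁻¹ • v), fun w => ?_, ?_⟩
  · have h1 := analyticAt_form H hH (Fin.cons (fun y => (fderiv ℂ s y v)⁻¹ • v) fun k _ => w k)
      (Fin.cases ((hd.inv hd0).smul analyticAt_const) fun _ => analyticAt_const)
    refine h1.congr (Eventually.of_forall fun y => ?_)
    exact congrArg (H y) (funext fun k => Fin.cases rfl (fun _ => rfl) k)
  · filter_upwards [continuous_toAmbient.continuousAt.eventually hηH,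
      continuousAt_subtype_val.eventually (hd.continuousAt.eventually_ne hd0)] with y h1 h2 t
    rw [residue_apply hs η y ⟨(fderiv ℂ s y.1 v)⁻¹ • v, mem_T_ambient _ _⟩ (by
      rw [map_smul, smul_eq_mul, inv_mul_cancel₀ h2]), h1]
    exact congrArg (H y.1) (funext fun k => Fin.cases rfl (fun _ => rfl) k)

/-- The dependence of the residue on the defining function. -/
theorem residue_eq_pow_smul (hα : α ≠ 0) {Ω : O.FormFamily D} {c : O.DivisorChart D}
    {s s' : Cn (m + 1) → ℂ} {η η' : O.ChartForm D c} (hs : IsDefiningFunction c.1 D s)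
    (hs' : IsDefiningFunction c.1 D s') (h : IsExtension α Ω c s η)
    (h' : IsExtension α Ω c s' η') (z : (O.suborbifoldSystem D).carrier c) {a : ℂ} (ha0 : a ≠ 0)
    (ha : ∀ w, fderiv ℂ s' z.1 w = a * fderiv ℂ s z.1 w) :
    residue hs' η' z = a ^ (α - 1) • residue hs η z := by
  refine AlternatingMap.ext fun t => ?_
  obtain ⟨v, hv⟩ := hs.exists_fderiv_eq_one z.2
  let v' : (O.ambientSystem D).T c (toAmbient z) := ⟨v, mem_T_ambient _ _⟩
  -- The normal vector for `s'` is `a⁻¹ • v`; against the factor `a^α` of the extension it leaves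
  -- `a^(α-1)`, where the truncated subtraction is harmless as `α ≠ 0`.
  have hv' : fderiv ℂ s' z.1 (a⁻¹ • v' : (O.ambientSystem D).T c (toAmbient z)).1 = 1 := by
    change fderiv ℂ s' z.1 (a⁻¹ • v) = 1
    rw [map_smul, ha, hv, smul_eq_mul, mul_one, inv_mul_cancel₀ ha0]
  have h1 : η (toAmbient z) (Fin.cons (a⁻¹ • v') fun k => inclT z (t k))
      = a⁻¹ * η (toAmbient z) (Fin.cons v' fun k => inclT z (t k)) :=
    congrArg (fun f => f fun k => inclT z (t k)) ((η (toAmbient z)).curryLeft.map_smul a⁻¹ v')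
  rw [residue_apply hs' η' z _ hv', h.eq_pow_smul hα hs hs' h' z ha, AlternatingMap.smul_apply,
    AlternatingMap.smul_apply, residue_apply hs η z v' hv, h1, smul_eq_mul, smul_eq_mul, ← mul_assoc]
  congr 1
  obtain ⟨k, rfl⟩ := Nat.exists_eq_succ_of_ne_zero hα
  rw [Nat.succ_sub_one, Nat.succ_eq_add_one, pow_succ, mul_inv_cancel_right₀ ha0]

/-- The residue commutes with pull-back under injections of charts. -/
theorem residue_pull {c c' : O.DivisorChart D} (l : (O.suborbifoldSystem D).Inj c c')
    {s : Cn (m + 1) → ℂ} (hs : IsDefiningFunction c'.1 D s) (η : O.ChartForm D c')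
    (z : (O.suborbifoldSystem D).carrier c) :
    residue (hs.comp l.2) (fun x => (O.canonicalX D).pull (i := c) (j := c') l x
        (η (ChartSystem.app (S := O.ambientSystem D) l x))) z
      = (O.canonicalD D).pull l z (residue hs η (ChartSystem.app l z)) := by
  refine AlternatingMap.ext fun t => ?_
  obtain ⟨v, hv⟩ := (hs.comp l.2).exists_fderiv_eq_one z.2
  -- A normal vector for `s ∘ l` is pushed forward by `dl` to a normal vector for `s`, so both
  -- residues evaluate `η` on the same vectors.
  have hv' : fderiv ℂ s (l.1 z.1) (fderiv ℂ l.1 z.1 v) = 1 := by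
    rw [← hs.fderiv_comp_apply l.2 z.2.1, hv]
  refine (residue_apply (hs.comp l.2) _ z ⟨v, mem_T_ambient _ _⟩ hv t).trans
    (Eq.trans ?_ (residue_apply hs η (ChartSystem.app l z)
    ⟨fderiv ℂ l.1 z.1 v, mem_T_ambient _ _⟩ hv' fun k => ChartSystem.tangentEquiv l z (t k)).symm)
  exact congrArg (η _) (funext fun k => Fin.cases rfl (fun _ => rfl) k)

/-- Off `D`, invariance of `Ω` gives `l^*(s^α Ω) = (s ∘ l)^α Ω`. This turns a change of chart into a
change of defining function on a single chart. -/
theorem IsVolumeFormWithPole.isExtension_pull {Ω : O.FormFamily D}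
    (hΩ : O.IsVolumeFormWithPole D α Ω) {c c' : O.DivisorChart D}
    (l : (O.ambientSystem D).Inj c c') {s : Cn (m + 1) → ℂ} {η : O.ChartForm D c'}
    (h : IsExtension α Ω c' s η) :
    IsExtension α Ω c (s ∘ l.1)
      (fun x => (O.canonicalX D).pull l x (η (ChartSystem.app l x))) where
  isHol x := (O.canonicalX D).isHol_pull l x η (h.isHol _)
  eq_smul x hx := by
    have hx' : c'.1.proj (ChartSystem.app l x).1 ∉ D := by
      rw [IsInjection.proj_comp l.2 x.1 x.2]
      exact hx
    rw [← hΩ.pull_eq c c' l x hx]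
    exact (congrArg ((O.canonicalX D).pull l x) (h.eq_smul _ hx')).trans
      (AlternatingMap.ext fun _ => rfl)

/-! ### Differentials of defining functions as conormal sections -/

/-- The differential of a defining function along `D`, as a section of the conormal bundle. -/
noncomputable def conormalOf {c : O.DivisorChart D} {s : Cn (m + 1) → ℂ} (hs : IsDefiningFunction c.1 D s)
    (z : (O.suborbifoldSystem D).carrier c) : ((O.suborbifoldSystem D).T c z).dualAnnihilator :=
  ⟨(fderiv ℂ s z.1 : Cn (m + 1) →ₗ[ℂ] ℂ), (Submodule.mem_dualAnnihilator _).2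
    fun _ hw => (hs.mem_tangent_iff z.2).1 hw⟩

theorem conormalOf_ne_zero {c : O.DivisorChart D} {s : Cn (m + 1) → ℂ}
    (hs : IsDefiningFunction c.1 D s) (z : (O.suborbifoldSystem D).carrier c) :
    conormalOf hs z ≠ 0 := fun h => by
  obtain ⟨v, hv⟩ := hs.exists_fderiv_eq_one z.2
  have h1 := LinearMap.congr_fun (congrArg Subtype.val h) v
  exact one_ne_zero (hv.symm.trans h1)

theorem isHol_conormalOf {c : O.DivisorChart D} {s : Cn (m + 1) → ℂ}
    (hs : IsDefiningFunction c.1 D s) (z : (O.suborbifoldSystem D).carrier c) :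
    (O.conormalD D).IsHol c z (conormalOf hs) :=
  ⟨fun y => (fderiv ℂ s y : Cn (m + 1) →ₗ[ℂ] ℂ),
    fun v => analyticAt_fderiv_apply (hs.holomorphic z.1 z.2.1) v, Eventually.of_forall fun _ => rfl⟩

theorem pull_conormalOf {c c' : O.DivisorChart D} (l : (O.suborbifoldSystem D).Inj c c')
    {s : Cn (m + 1) → ℂ} (hs : IsDefiningFunction c'.1 D s)
    (z : (O.suborbifoldSystem D).carrier c) :
    (O.conormalD D).pull l z (conormalOf hs (ChartSystem.app l z)) = conormalOf (hs.comp l.2) z :=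
  Subtype.ext (LinearMap.ext fun v => (hs.fderiv_comp_apply l.2 z.2.1 v).symm)

theorem conormalOf_eq_smul {c : O.DivisorChart D} {s s' : Cn (m + 1) → ℂ}
    (hs : IsDefiningFunction c.1 D s) {z : (O.suborbifoldSystem D).carrier c}
    {ν : ((O.suborbifoldSystem D).T c z).dualAnnihilator} (hν : ∀ w, ν.1 w = fderiv ℂ s' z.1 w)
    {a : ℂ} (ha : ∀ w, fderiv ℂ s' z.1 w = a * fderiv ℂ s z.1 w) : ν = a • conormalOf hs z :=
  Subtype.ext (LinearMap.ext fun w => (hν w).trans (ha w))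

/-! ### The volume form and its residue isomorphism -/

/-- The anticanonical condition yields a volume form with a pole of order `α` along `D`. -/
theorem AnticanonicalEq.exists_volumeForm (h : O.AnticanonicalEq D α) :
    ∃ Ω : O.FormFamily D, O.IsVolumeFormWithPole D α Ω := by
  obtain ⟨Z, ⟨Φ⟩⟩ := h
  -- The fibres of `[D]` over the charts are `ℂ`, and `1^{⊗α}` trivialises `α[D]` there; it
  -- transforms by `ξ^α`, so `η` transforms by `ξ^{-α}`.
  obtain ⟨η, hη, hpull⟩ := LineOrbibundle.exists_sections_of_dual_iso Φ
    (fun _ _ => PiTensorProduct.tprod ℂ fun _ : Fin α => (1 : ℂ))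
    (fun _ _ => LineOrbibundle.isHol_tprod (L := Z.lineOrbibundle) α (ChartSystem.HolFun.const 1))
    (fun _ _ => LineOrbibundle.tprod_const_ne_zero α (one_ne_zero (α := ℂ)))
  let H : ∀ c, O.ChartForm D c := η
  have hf : ∀ (c : O.DivisorChart D) (x : (O.ambientSystem D).carrier c), c.1.proj x.1 ∉ D →
      Z.f c x.1 ≠ 0 := fun c x hx h0 => hx (((Z.isDefining c).zero_iff x.1 x.2).1 h0)
  -- Since `f_i = ξ · (f_j ∘ l)`, the factor `f^{-α}` absorbs the cocycle of `η` and makes the form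
  -- invariant. Its values along `D`, where `f = 0`, play no role.
  refine ⟨fun c x => (Z.f c x.1 ^ α)⁻¹ • H c x,
    fun c x hx => ?_, fun c x hx => ?_, fun c c' l x hx => ?_, fun c => ?_⟩
  · refine (hη c x).1.smul (ChartSystem.HolFun.inv ⟨fun y => Z.f c y ^ α, ?_,
      Eventually.of_forall fun _ => rfl⟩ (pow_ne_zero α (hf c x hx)))
    exact ((Z.isDefining c).holomorphic x.1 x.2).pow α
  · exact smul_ne_zero (inv_ne_zero (pow_ne_zero α (hf c x hx))) (hη c x).2
  · have h1 : (Z.lineOrbibundle.pow α).pull l x (PiTensorProduct.tprod ℂ fun _ : Fin α => (1 : ℂ))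
        = Z.ξ l x ^ α • PiTensorProduct.tprod ℂ fun _ : Fin α => (1 : ℂ) := by
      refine (LineOrbibundle.pull_tprod (L := Z.lineOrbibundle) α l x (1 : ℂ)).trans ?_
      have h2 : Z.lineOrbibundle.pull l x (1 : ℂ) = Z.ξ l x • (1 : ℂ) := rfl
      rw [h2]
      exact LineOrbibundle.tprod_const_smul α (Z.ξ l x) (1 : ℂ)
    have h3 := hpull l x _ h1
    refine ((O.canonicalX D).pull_smul l x (Z.f c' (l.1 x.1) ^ α)⁻¹ (η c' _)).trans ?_
    have h4 : (Z.f c' (l.1 x.1) ^ α)⁻¹ * (Z.ξ l x ^ α)⁻¹ = (Z.f c x.1 ^ α)⁻¹ := by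
      rw [Z.f_eq l x, mul_pow, mul_inv, mul_comm]
    rw [h3]
    exact (smul_smul _ _ (H c x)).trans (congrArg (· • H c x) h4)
  · refine ⟨Z.f c, Z.isDefining c, η c, hη c, fun x hx => ?_⟩
    exact (smul_inv_smul₀ (pow_ne_zero α (hf c x hx)) _).symm

/-- The Poincaré residue of a volume form with a pole of order `α` along `D` defines a unique
isomorphism `(α - 1) N_D^* ≅ K_D`. -/
theorem IsVolumeFormWithPole.existsUnique_residueIso (hα : α ≠ 0) {Ω : O.FormFamily D}
    (hΩ : O.IsVolumeFormWithPole D α Ω) :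
    ∃! ψ : ((O.conormalD D).pow (α - 1)).Iso (O.canonicalD D), O.IsPoincareResidue D α Ω ψ := by
  choose s hs η hη hηΩ using hΩ.pole
  have hext : ∀ c, IsExtension α Ω c (s c) (η c) := fun c => ⟨fun x => (hη c x).1, hηΩ c⟩
  let e : ∀ (c : (O.suborbifoldSystem D).Chart) (z : (O.suborbifoldSystem D).carrier c),
      ((O.conormalD D).pow (α - 1)).Fiber c z :=
    fun c z => PiTensorProduct.tprod ℂ fun _ : Fin (α - 1) => conormalOf (hs c) z
  let ρ : ∀ (c : (O.suborbifoldSystem D).Chart) (z : (O.suborbifoldSystem D).carrier c),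
      (O.canonicalD D).Fiber c z := fun c z => residue (hs c) (η c) z
  have he : ∀ c z, ((O.conormalD D).pow (α - 1)).IsHol c z (e c) := fun c z =>
    LineOrbibundle.isHol_tprod (L := O.conormalD D) (α - 1) (isHol_conormalOf (hs c) z)
  have he0 : ∀ c z, e c z ≠ 0 := fun c z =>
    LineOrbibundle.tprod_const_ne_zero (α - 1) (conormalOf_ne_zero (hs c) z)
  have hρ : ∀ c z, (O.canonicalD D).IsHol c z (ρ c) := fun c z =>
    isHol_residue (hs c) (η c) z (hη c _).1
  have hρ0 : ∀ c z, ρ c z ≠ 0 := fun c z => residue_ne_zero (hs c) (η c) z (hη c _).2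
  have hpull : ∀ {c c' : (O.suborbifoldSystem D).Chart} (l : (O.suborbifoldSystem D).Inj c c')
      (z : (O.suborbifoldSystem D).carrier c), ∃ a : ℂ,
      ((O.conormalD D).pow (α - 1)).pull l z (e c' (ChartSystem.app l z)) = a • e c z ∧
      (O.canonicalD D).pull l z (ρ c' (ChartSystem.app l z)) = a • ρ c z := by
    intro c c' l z
    -- Here `a` compares the pulled-back defining function of `c'` with the one chosen on `c`; both
    -- families of sections transform by `a^(α-1)`.
    obtain ⟨a, ha0, ha⟩ := (hs c).exists_fderiv_eq_smul ((hs c').comp l.2) z.2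
    refine ⟨a ^ (α - 1), ?_, ?_⟩
    · refine (LineOrbibundle.pull_tprod (L := O.conormalD D) (α - 1) l z _).trans ?_
      rw [pull_conormalOf l (hs c') z,
        conormalOf_eq_smul (hs c) (ν := conormalOf ((hs c').comp l.2) z) (fun _ => rfl) ha]
      exact LineOrbibundle.tprod_const_smul (α - 1) a (conormalOf (hs c) z)
    · refine (residue_pull l (hs c') (η c') z).symm.trans ?_
      exact residue_eq_pow_smul hα (hs c) ((hs c').comp l.2) (hext c)
        (hΩ.isExtension_pull l (hext c')) z ha0 ha
  refine ⟨.ofSections e ρ he hρ he0 hρ0 hpull, ?_, fun ψ hψ => ?_⟩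
  · intro c s' hs' η' hη' hηΩ' z ν hν v hv t
    -- The residue formula is built in only for the chosen `s c`. For an arbitrary `s'`, both sides
    -- acquire the same factor `a^(α-1)`.
    obtain ⟨a, ha0, ha⟩ := (hs c).exists_fderiv_eq_smul hs' z.2
    refine Eq.trans ?_ (residue_apply hs' η' z v hv t)
    rw [residue_eq_pow_smul hα (hs c) hs' (hext c) ⟨hη', hηΩ'⟩ z ha0 ha,
      conormalOf_eq_smul (hs c) hν ha]
    refine congrArg (fun f => ChartSystem.evalForm (S := O.suborbifoldSystem D) f t) ?_
    rw [LineOrbibundle.tprod_const_smul (α - 1) a (conormalOf (hs c) z)]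
    refine (LineOrbibundle.Iso.equiv_smul _ z (a ^ (α - 1)) (e c z)).trans ?_
    exact congrArg
      (fun w : ((O.suborbifoldSystem D).T c z) [⋀^Fin m]→ₗ[ℂ] ℂ => a ^ (α - 1) • w)
      (LineOrbibundle.Iso.ofSections_equiv (S := O.suborbifoldSystem D) c z)
  -- The residue condition, applied to the chosen `s c` and `η c`, already prescribes `ψ` on the
  -- generators `e`.
  · refine LineOrbibundle.Iso.ext_of_sections e he0 fun c z =>
      Eq.trans ?_ (LineOrbibundle.Iso.ofSections_equiv (S := O.suborbifoldSystem D) c z).symm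
    obtain ⟨v, hv⟩ := (hs c).exists_fderiv_eq_one z.2
    refine AlternatingMap.ext fun t => ?_
    refine (hψ c (s c) (hs c) (η c) (hext c).isHol (hηΩ c) z (conormalOf (hs c) z) (fun _ => rfl)
      ⟨v, mem_T_ambient _ _⟩ hv t).trans ?_
    exact (residue_apply (hs c) (η c) z ⟨v, mem_T_ambient _ _⟩ hv t).symm

end ComplexOrbifold

end OrbiAdj

theorem proposition2p1 {X : Type*} [TopologicalSpace X] [CompactSpace X] [T2Space X] {m : ℕ}
    (O : OrbiAdj.ComplexOrbifold X (m + 1)) (hK : ∃ g, O.IsKahlerMetric g)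
    (D : Set X) (hD : O.IsSuborbifold D) (hconn : IsConnected D) (hsing : O.singularSet ⊆ D)
    (α : ℕ) (hα : 2 ≤ α) (hanti : O.AnticanonicalEq D α) (hbasic : O.BasicAssumption D α) :
    Nonempty ((O.canonicalD D).Iso ((O.conormalD D).pow (α - 1))) ∧
    (∃ Ω : O.FormFamily D, O.IsVolumeFormWithPole D α Ω) ∧
    ∀ Ω : O.FormFamily D, O.IsVolumeFormWithPole D α Ω →
      ∃! ψ : ((O.conormalD D).pow (α - 1)).Iso (O.canonicalD D), O.IsPoincareResidue D α Ω ψ := by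
  have hα0 : α ≠ 0 := by omega
  obtain ⟨Ω, hΩ⟩ := hanti.exists_volumeForm
  obtain ⟨ψ, -, -⟩ := hΩ.existsUnique_residueIso hα0
  -- The residue isomorphism runs from the conormal power to `K_D`, hence the inverse.
  exact ⟨⟨ψ.symm⟩, ⟨Ω, hΩ⟩, fun Ω' hΩ' => hΩ'.existsUnique_residueIso hα0⟩
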